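/- **Setting.** Let $L$ be a finite-dimensional complex Lie superalgebra with a Cartan subalgebra $H\subseteq L_{\bar 0}$ (so $L$ is the direct sum of the weight spaces of $\mathrm{ad}\,H$, and the zero weight space is $H$), a nondegenerate even supersymmetric invariant form $(\ ,\ )$, linearly independent simple roots $\alpha_i\in H^*$ $(i\in I)$ of parity $[i]\in\mathbb Z/2$, and simple generators $e_i\in L_{\alpha_i}$, $f_i\in L_{-\alpha_i}$ of parity $[i]$ which together with $H$ generate $L$ and satisfy $[e_i,f_j]=\delta_{ij}h_i$. Here, for $\mu\in H^*$, $h_\mu\in H$ is defined by $(h_\mu,h)=\mu(h)$ for all $h\in H$, $h_i=h_{\alpha_i}$, and $(\lambda,\mu)=\lambda(h_\mu)$. (This covers the basic classical simple Lie superalgebras with linearly independent simple roots, and $gl(m|n)$.) Let $\rho=\rho_0-\rho_1$ with $\rho_0,\rho_1$ half the sum of the even, respectively odd, positive roots (counted with multiplicity), a root being positive if it is a nonzero sum of simple roots. Let $q=e^{\eta}$ with $\eta\in\mathbb C$, $q\neq q^{-1}$, and $q^x:=e^{\eta x}$ for $x\in\mathbb C$. The quantum supergroup $U_q(L)$ is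 the superalgebra generated by $e_i,f_i$ (of parity $[i]$) and even $q^h$ $(h\in H)$ with $q^0=1$, $q^hq^{h'}=q^{h+h'}$, $q^he_i=q^{\alpha_i(h)}e_iq^h$, $q^hf_i=q^{-\alpha_i(h)}f_iq^h$, $e_if_j-(-1)^{[i][j]}f_je_i=\delta_{ij}\frac{q^{h_i}-q^{-h_i}}{q-q^{-1}}$, and coproduct $\Delta(x)=q^{h_i/2}\otimes x+x\otimes q^{-h_i/2}$ for $x=e_i,f_i$, $\Delta(q^h)=q^h\otimes q^h$, modulo the largest graded Hopf ideal that meets $\mathrm{span}\{q^h\}$ trivially (for generic $q$: the quantum Serre relations). Tensor products carry the sign rule $(a\otimes b)(c\otimes d)=(-1)^{[b][c]}ac\otimes bd$; let $T(a\otimes b)=(-1)^{[a][b]}b\otimes a$, $\Delta^T=T\circ\Delta$, $R^T=T(R)$. Let $R$ be a universal $R$-matrix of $U_q(L)$: a formal series $R=q^{\sum_i x_i\otimes x^i}\sum_\nu\theta_\nu$, where $(x_i)$, $(x^i)$ are dual bases of $H$, $\nu$ runs over the formal sums of simple roots, $\theta_0=1\otimes1$, and $\theta_\nu\in U^-_{-\nu}\otimes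 U^+_{\nu}$, with $U^{\pm}_{\pm\nu}$ the weight $\pm\nu$ part of the subalgebra generated by the $q^h$ and the $e_i$ (respectively the $f_i$), such that $$R\,\Delta(a)=\Delta^T(a)R\quad(a\in U_q(L)),\qquad(\Delta\otimes\mathrm{id})R=R_{13}R_{23},\qquad(\mathrm{id}\otimes\Delta)R=R_{13}R_{12};$$ identities of such series are understood after applying finite-dimensional weight representations to tensor factors, which makes the series finite. Let $V(\Lambda)$ be a finite-dimensional irreducible $U_q(L)$-module with highest weight $\Lambda\in H^*$, with a homogeneous basis of weight vectors $e_\alpha$ (parity $[\alpha]$, weight $\lambda_\alpha$, i.e. $q^he_\alpha=q^{\lambda_\alpha(h)}e_\alpha$), and let $\pi_\Lambda$ be its representation. Put $$A=(q-q^{-1})^{-1}(\pi_\Lambda\otimes\mathrm{id})(1\otimes1-R^TR),$$ regarded as the matrix with entries $A_{\beta\alpha}\in U_q(L)$ given by $A(e_\alpha\otimes w)=\sum_\beta e_\beta\otimes A_{\beta\alpha}w$ for $w$ in any $U_q(L)$-module, so that powers $A^m$ are ordinary matrix powers. **Statement.** For every $m\ge0$ the element $$C_m^\Lambda=\mathrm{str}_\Lambda\left(q^{2h_\rho}A^m\right)=\sum_\alpha(-1)^{[\alpha]}q^{2(\rho,\lambda_\alpha)}(A^m)_{\alpha\alpha}\in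 U_q(L)$$ commutes with every element of $U_q(L)$: $\ a\,C_m^\Lambda=C_m^\Lambda\,a$ for all $a\in U_q(L)$. -/

import Mathlib

open scoped TensorProduct

noncomputable section

namespace QSuper

/-! ### Signs and superalgebras -/

/-- The sign `(-1)^s` as a complex number. -/
def sgn (s : ZMod 2) : ℂ := if s = 0 then 1 else -1

theorem sgn_zero : sgn 0 = 1 := by simp [sgn]

theorem sgn_one : sgn 1 = -1 := by simp [sgn]

theorem zmod_two_cases (s : ZMod 2) : s = 0 ∨ s = 1 := by
  revert s; decide

theorem sgn_add (s t : ZMod 2) : sgn (s + t) = sgn s * sgn t := by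
  have h : (1 : ZMod 2) + 1 = 0 := by decide
  rcases zmod_two_cases s with rfl | rfl <;> rcases zmod_two_cases t with rfl | rfl <;>
    simp [sgn_zero, sgn_one, h]

theorem sgn_mul_self (s : ZMod 2) : sgn s * sgn s = 1 := by
  rcases zmod_two_cases s with rfl | rfl <;> simp [sgn_zero, sgn_one]

theorem units_smul_eq_sgn {M : Type*} [AddCommGroup M] [Module ℂ M] (s : ZMod 2) (x : M) :
    ((-1 : ℤˣ) ^ s) • x = sgn s • x := by
  rcases zmod_two_cases s with rfl | rfl
  · simp [sgn_zero]
  · simp [sgn_one, Units.smul_def]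

section Parity

variable {A : Type*} [Ring A] [Algebra ℂ A]

/-- The homogeneous component of degree `s` with respect to the parity automorphism `σ`. -/
def parityPart (σ : A →ₐ[ℂ] A) (s : ZMod 2) : Submodule ℂ A where
  carrier := {a | σ a = sgn s • a}
  add_mem' {a b} ha hb := by
    simp only [Set.mem_ofPred_eq] at ha hb ⊢
    rw [map_add, ha, hb, smul_add]
  zero_mem' := by simp
  smul_mem' c a ha := by
    simp only [Set.mem_ofPred_eq] at ha ⊢
    rw [map_smul, ha, smul_comm]

theorem mem_parityPart {σ : A →ₐ[ℂ] A} {s : ZMod 2} {a : A} :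
    a ∈ parityPart σ s ↔ σ a = sgn s • a := Iff.rfl

/-- The projection `(1 ± σ)/2` onto the component of degree `s`. -/
def parityProj (σ : A →ₐ[ℂ] A) (hσ : ∀ a, σ (σ a) = a) (s : ZMod 2) : A →ₗ[ℂ] parityPart σ s where
  toFun a := ⟨(1 / 2 : ℂ) • (a + sgn s • σ a), by
    rw [mem_parityPart, map_smul, map_add, map_smul, hσ, smul_comm (sgn s) (1 / 2 : ℂ),
      smul_add (sgn s), smul_smul (sgn s) (sgn s), sgn_mul_self, one_smul, add_comm]⟩
  map_add' a b := by
    ext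
    simp only [map_add, Submodule.coe_add]
    module
  map_smul' c a := by
    ext
    simp only [map_smul, Submodule.coe_smul, RingHom.id_apply]
    module

theorem parityProj_coe (σ : A →ₐ[ℂ] A) (hσ : ∀ a, σ (σ a) = a) (s : ZMod 2) (a : A) :
    (parityProj σ hσ s a : A) = (1 / 2 : ℂ) • (a + sgn s • σ a) := rfl

/-- The decomposition of an element into its even and odd parts. -/
def parityDecompose (σ : A →ₐ[ℂ] A) (hσ : ∀ a, σ (σ a) = a) :
    A →ₗ[ℂ] DirectSum (ZMod 2) fun s => parityPart σ s :=
  ∑ s : ZMod 2, (DirectSum.lof ℂ (ZMod 2) (fun s => parityPart σ s) s) ∘ₗ parityProj σ hσ s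

theorem parityDecompose_apply (σ : A →ₐ[ℂ] A) (hσ : ∀ a, σ (σ a) = a) (a : A) :
    parityDecompose σ hσ a = DirectSum.lof ℂ (ZMod 2) (fun s => parityPart σ s) 0 (parityProj σ hσ 0 a)
      + DirectSum.lof ℂ (ZMod 2) (fun s => parityPart σ s) 1 (parityProj σ hσ 1 a) := by
  rw [parityDecompose, show (Finset.univ : Finset (ZMod 2)) = {0, 1} by decide,
    Finset.sum_pair (by decide)]
  rfl

/-- An algebra with an involutive automorphism is a superalgebra. -/
@[reducible]
def parityGraded (σ : A →ₐ[ℂ] A) (hσ : ∀ a, σ (σ a) = a) : GradedAlgebra (parityPart σ) :=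
  { one_mem := by simp [mem_parityPart, sgn_zero]
    mul_mem := by
      intro s t a b ha hb
      rw [mem_parityPart] at ha hb ⊢
      rw [map_mul, ha, hb, sgn_add, smul_mul_smul_comm]
    toDecomposition := DirectSum.Decomposition.ofLinearMap _ (parityDecompose σ hσ)
      (by
        ext a
        rw [LinearMap.comp_apply, parityDecompose_apply, map_add, DirectSum.coeLinearMap_lof,
          DirectSum.coeLinearMap_lof, parityProj_coe, parityProj_coe, sgn_zero, sgn_one,
          LinearMap.id_apply]
        module)
      (by
        refine DirectSum.linearMap_ext ℂ fun t => LinearMap.ext fun x => ?_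
        rw [LinearMap.comp_apply, LinearMap.comp_apply, DirectSum.coeLinearMap_lof,
          parityDecompose_apply, LinearMap.comp_apply, LinearMap.id_apply]
        have hx : σ x = sgn t • (x : A) := x.2
        have hs : ∀ s, (parityProj σ hσ s x : A) = (1 / 2 * (1 + sgn s * sgn t) : ℂ) • (x : A) := by
          intro s
          rw [parityProj_coe, hx]
          module
        rcases zmod_two_cases t with rfl | rfl
        · have h0 : parityProj σ hσ 0 x = x := by ext; rw [hs]; norm_num [sgn_zero]
          have h1 : parityProj σ hσ 1 x = 0 := by ext; rw [hs]; simp [sgn_zero, sgn_one]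
          rw [h0, h1, map_zero, add_zero]
        · have h0 : parityProj σ hσ 0 x = 0 := by ext; rw [hs]; simp [sgn_zero, sgn_one]
          have h1 : parityProj σ hσ 1 x = x := by ext; rw [hs]; norm_num [sgn_one]
          rw [h0, h1, map_zero, zero_add]) }

end Parity

/-! ### Lie superalgebras with Chevalley generators -/

/-- A complex Lie superalgebra structure on `L`. -/
structure LieSuperalgebra (L : Type*) [AddCommGroup L] [Module ℂ L] where
  gr : ZMod 2 → Submodule ℂ L
  isInternal : DirectSum.IsInternal gr
  br : L →ₗ[ℂ] L →ₗ[ℂ] L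
  br_mem : ∀ {s t x y}, x ∈ gr s → y ∈ gr t → br x y ∈ gr (s + t)
  skew : ∀ {s t x y}, x ∈ gr s → y ∈ gr t → br x y = -(sgn (s * t) • br y x)
  jacobi : ∀ {s t x y} (z : L), x ∈ gr s → y ∈ gr t →
    br x (br y z) = br (br x y) z + sgn (s * t) • br y (br x z)

/-- The simultaneous eigenspace of `ad H` of weight `β`. -/
def LieSuperalgebra.rootSpace {L : Type*} [AddCommGroup L] [Module ℂ L] (S : LieSuperalgebra L)
    (H : Submodule ℂ L) (β : Module.Dual ℂ H) : Submodule ℂ L where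
  carrier := {x | ∀ h : H, S.br h x = β h • x}
  add_mem' {x y} hx hy := by
    intro h
    rw [map_add, hx h, hy h, smul_add]
  zero_mem' := by
    intro h
    simp
  smul_mem' c x hx := by
    intro h
    rw [map_smul, hx h, smul_comm]

/-- A Lie superalgebra with a Cartan subalgebra `H`, an even supersymmetric invariant
nondegenerate form, and simple generators `e i`, `f i`, `h_i = [e i, f i]`, where `h_i ∈ H` is dual
to the simple root `α_i` under the form.  The basic classical simple Lie superalgebras
with linearly independent simple roots, and `gl(m|n)`, are of this kind. -/
structure BasicLieSuperalgebra (ι L : Type*) [AddCommGroup L] [Module ℂ L] extends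
    LieSuperalgebra L where
  /-- The Cartan subalgebra. -/
  cartan : Submodule ℂ L
  cartan_even : cartan ≤ gr 0
  rootSpace_zero : toLieSuperalgebra.rootSpace cartan 0 = cartan
  iSup_rootSpace : ⨆ β, toLieSuperalgebra.rootSpace cartan β = ⊤
  /-- The invariant bilinear form. -/
  form : LinearMap.BilinForm ℂ L
  form_even : ∀ {x y}, x ∈ gr 0 → y ∈ gr 1 → form x y = 0
  form_super : ∀ {s t x y}, x ∈ gr s → y ∈ gr t → form x y = sgn (s * t) * form y x
  form_inv : ∀ x y z, form (br x y) z = form x (br y z)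
  form_nondeg : form.Nondegenerate
  /-- The simple roots. -/
  root : ι → Module.Dual ℂ cartan
  root_indep : LinearIndependent ℂ root
  /-- The parities of the simple roots. -/
  parity : ι → ZMod 2
  e : ι → L
  f : ι → L
  e_even : ∀ i, e i ∈ gr (parity i)
  f_even : ∀ i, f i ∈ gr (parity i)
  e_root : ∀ i, e i ∈ toLieSuperalgebra.rootSpace cartan (root i)
  f_root : ∀ i, f i ∈ toLieSuperalgebra.rootSpace cartan (-root i)
  e_f_same : ∀ i (h : cartan), form (br (e i) (f i)) h = root i h
  e_f_ne : ∀ i j, i ≠ j → br (e i) (f j) = 0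
  generated : ∀ W : Submodule ℂ L, cartan ≤ W → (∀ i, e i ∈ W) → (∀ i, f i ∈ W) →
    (∀ x ∈ W, ∀ y ∈ W, br x y ∈ W) → W = ⊤

/-- Cartan data: a space `𝔥` with a symmetric nondegenerate form, simple roots and parities. -/
structure CartanDatum (ι 𝔥 : Type*) [AddCommGroup 𝔥] [Module ℂ 𝔥] where
  form : LinearMap.BilinForm ℂ 𝔥
  form_symm : ∀ x y, form x y = form y x
  form_nondeg : form.Nondegenerate
  root : ι → Module.Dual ℂ 𝔥
  parity : ι → ZMod 2

namespace BasicLieSuperalgebra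

variable {ι L : Type*} [AddCommGroup L] [Module ℂ L] (S : BasicLieSuperalgebra ι L)

theorem cartan_symm (x y : S.cartan) : S.form x y = S.form y x := by
  have h := S.form_super (S.cartan_even x.2) (S.cartan_even y.2)
  simpa [sgn_zero] using h

theorem cartan_separating (x : S.cartan) (hx : ∀ y : S.cartan, S.form x y = 0) : x = 0 := by
  have key : ∀ z : L, S.form x z = 0 := by
    intro z
    have hz : z ∈ ⨆ β, S.toLieSuperalgebra.rootSpace S.cartan β := by
      rw [S.iSup_rootSpace]; trivial
    induction hz using Submodule.iSup_induction' with
    | mem β z hz =>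
      by_cases hβ : β = 0
      · subst hβ
        rw [S.rootSpace_zero] at hz
        exact hx ⟨z, hz⟩
      · obtain ⟨h, hh⟩ : ∃ h, β h ≠ 0 := by
          by_contra hcon
          push Not at hcon
          exact hβ (LinearMap.ext hcon)
        have h1 : S.br x (h : L) = 0 := by
          have h2 : (h : L) ∈ S.toLieSuperalgebra.rootSpace S.cartan 0 := by
            rw [S.rootSpace_zero]; exact h.2
          simpa using h2 x
        have h3 := S.form_inv x h z
        rw [h1, hz h] at h3
        simp only [map_zero, LinearMap.zero_apply, map_smul, smul_eq_mul] at h3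
        exact (mul_eq_zero.mp h3.symm).resolve_left hh
    | zero => simp
    | add z w _ _ hz hw => rw [map_add, hz, hw, add_zero]
  exact Subtype.ext (S.form_nondeg.1 _ key)

theorem cartan_nondeg : (S.form.restrict S.cartan).Nondegenerate := by
  refine ⟨fun x hx => S.cartan_separating x fun y => hx y,
    fun x hx => S.cartan_separating x fun y => ?_⟩
  rw [cartan_symm]
  exact hx y

/-- The Cartan data of `L`. -/
def datum : CartanDatum ι S.cartan where
  form := S.form.restrict S.cartan
  form_symm := S.cartan_symm
  form_nondeg := S.cartan_nondeg
  root := S.root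
  parity := S.parity

/-- The positive roots of parity `s`. -/
def posRoots (s : ZMod 2) : Set (Module.Dual ℂ S.cartan) :=
  {β | β ≠ 0 ∧ β ∈ AddSubmonoid.closure (Set.range S.root) ∧
    S.gr s ⊓ S.toLieSuperalgebra.rootSpace S.cartan β ≠ ⊥}

/-- Half the sum of the positive roots of parity `s`, each counted with its multiplicity. -/
def halfSum (s : ZMod 2) : Module.Dual ℂ S.cartan :=
  (1 / 2 : ℂ) • ∑ᶠ β ∈ S.posRoots s,
    (Module.finrank ℂ ↥(S.gr s ⊓ S.toLieSuperalgebra.rootSpace S.cartan β) : ℂ) • β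

/-- The graded half sum `ρ = ρ₀ - ρ₁` of the positive roots. -/
def rho : Module.Dual ℂ S.cartan := S.halfSum 0 - S.halfSum 1

end BasicLieSuperalgebra

/-! ### The quantum supergroup -/

/-- `q ^ x` for `q = exp η`. -/
def qpow (η x : ℂ) : ℂ := Complex.exp (η * x)

/-- `q - q⁻¹` for `q = exp η`. -/
def qdiff (η : ℂ) : ℂ := qpow η 1 - qpow η (-1)

theorem qpow_add (η x y : ℂ) : qpow η (x + y) = qpow η x * qpow η y := by
  rw [qpow, qpow, qpow, mul_add, Complex.exp_add]

theorem qpow_zero (η : ℂ) : qpow η 0 = 1 := by simp [qpow]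

/-- Generators: `e i`, `f i`, and `k h`, which stands for `q ^ h`, `h ∈ 𝔥`. -/
inductive Gen (ι 𝔥 : Type*)
  | e (i : ι) : Gen ι 𝔥
  | f (i : ι) : Gen ι 𝔥
  | k (h : 𝔥) : Gen ι 𝔥

section Quantum

variable {ι 𝔥 : Type*} [AddCommGroup 𝔥] [Module ℂ 𝔥] [FiniteDimensional ℂ 𝔥]

/-- `h_μ ∈ 𝔥`, dual to `μ` under the form: `λ (h_μ) = (λ, μ)`. -/
def CartanDatum.dualVec (D : CartanDatum ι 𝔥) (μ : Module.Dual ℂ 𝔥) : 𝔥 :=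
  (D.form.toDual D.form_nondeg).symm μ

/-- `h_i`, dual to the simple root `α_i`. -/
def CartanDatum.simpleH (D : CartanDatum ι 𝔥) (i : ι) : 𝔥 := D.dualVec (D.root i)

theorem CartanDatum.form_dualVec (D : CartanDatum ι 𝔥) (μ : Module.Dual ℂ 𝔥) (x : 𝔥) :
    D.form (D.dualVec μ) x = μ x := by
  rw [dualVec, LinearMap.BilinForm.apply_toDual_symm_apply]

theorem CartanDatum.root_simpleH_comm (D : CartanDatum ι 𝔥) (i j : ι) :
    D.root i (D.simpleH j) = D.root j (D.simpleH i) := by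
  rw [← D.form_dualVec (D.root i), ← D.form_dualVec (D.root j), D.form_symm]
  rfl

/-- The relations other than the Serre relations. -/
inductive Rel (η : ℂ) (D : CartanDatum ι 𝔥) :
    FreeAlgebra ℂ (Gen ι 𝔥) → FreeAlgebra ℂ (Gen ι 𝔥) → Prop
  | k_zero : Rel η D (FreeAlgebra.ι ℂ (.k 0)) 1
  | k_add (h h' : 𝔥) : Rel η D (FreeAlgebra.ι ℂ (.k h) * FreeAlgebra.ι ℂ (.k h'))
      (FreeAlgebra.ι ℂ (.k (h + h')))
  | k_e (h : 𝔥) (i : ι) : Rel η D (FreeAlgebra.ι ℂ (.k h) * FreeAlgebra.ι ℂ (.e i))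
      (qpow η (D.root i h) • (FreeAlgebra.ι ℂ (.e i) * FreeAlgebra.ι ℂ (.k h)))
  | k_f (h : 𝔥) (i : ι) : Rel η D (FreeAlgebra.ι ℂ (.k h) * FreeAlgebra.ι ℂ (.f i))
      (qpow η (-D.root i h) • (FreeAlgebra.ι ℂ (.f i) * FreeAlgebra.ι ℂ (.k h)))
  | e_f_same (i : ι) : Rel η D
      (FreeAlgebra.ι ℂ (.e i) * FreeAlgebra.ι ℂ (.f i)
        - sgn (D.parity i * D.parity i) • (FreeAlgebra.ι ℂ (.f i) * FreeAlgebra.ι ℂ (.e i)))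
      ((qdiff η)⁻¹ • (FreeAlgebra.ι ℂ (.k (D.simpleH i)) - FreeAlgebra.ι ℂ (.k (-D.simpleH i))))
  | e_f_ne (i j : ι) (hij : i ≠ j) : Rel η D
      (FreeAlgebra.ι ℂ (.e i) * FreeAlgebra.ι ℂ (.f j)
        - sgn (D.parity i * D.parity j) • (FreeAlgebra.ι ℂ (.f j) * FreeAlgebra.ι ℂ (.e i))) 0

/-- The algebra before the Serre relations are imposed. -/
def PreU (η : ℂ) (D : CartanDatum ι 𝔥) : Type _ := RingQuot (Rel η D)

variable (η : ℂ) (D : CartanDatum ι 𝔥)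

instance : Ring (PreU η D) := inferInstanceAs (Ring (RingQuot (Rel η D)))

instance : Algebra ℂ (PreU η D) := inferInstanceAs (Algebra ℂ (RingQuot (Rel η D)))

namespace PreU

def mk : FreeAlgebra ℂ (Gen ι 𝔥) →ₐ[ℂ] PreU η D := RingQuot.mkAlgHom ℂ (Rel η D)

def e (i : ι) : PreU η D := mk η D (FreeAlgebra.ι ℂ (.e i))

def f (i : ι) : PreU η D := mk η D (FreeAlgebra.ι ℂ (.f i))

def k (h : 𝔥) : PreU η D := mk η D (FreeAlgebra.ι ℂ (.k h))

theorem mk_rel {x y : FreeAlgebra ℂ (Gen ι 𝔥)} (h : Rel η D x y) : mk η D x = mk η D y :=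
  RingQuot.mkAlgHom_rel ℂ h

theorem k_zero : k η D 0 = 1 := by
  have h := mk_rel η D Rel.k_zero
  rwa [map_one] at h

theorem k_mul (h h' : 𝔥) : k η D h * k η D h' = k η D (h + h') := by
  have h := mk_rel η D (Rel.k_add h h')
  rwa [map_mul] at h

theorem k_e (h : 𝔥) (i : ι) : k η D h * e η D i = qpow η (D.root i h) • (e η D i * k η D h) := by
  have h := mk_rel η D (Rel.k_e h i)
  rwa [map_mul, map_smul, map_mul] at h

theorem k_f (h : 𝔥) (i : ι) : k η D h * f η D i = qpow η (-D.root i h) • (f η D i * k η D h) := by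
  have h := mk_rel η D (Rel.k_f h i)
  rwa [map_mul, map_smul, map_mul] at h

theorem e_f_same (i : ι) :
    e η D i * f η D i - sgn (D.parity i * D.parity i) • (f η D i * e η D i) =
      (qdiff η)⁻¹ • (k η D (D.simpleH i) - k η D (-D.simpleH i)) := by
  have h := mk_rel η D (Rel.e_f_same i)
  rwa [map_sub, map_smul, map_mul, map_mul, map_smul, map_sub] at h

theorem e_f_ne (i j : ι) (hij : i ≠ j) :
    e η D i * f η D j - sgn (D.parity i * D.parity j) • (f η D j * e η D i) = 0 := by
  have h := mk_rel η D (Rel.e_f_ne i j hij)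
  rwa [map_sub, map_smul, map_mul, map_mul, map_zero] at h

variable {η D} in
/-- The universal property. -/
def lift {B : Type*} [Ring B] [Algebra ℂ B] (E F : ι → B) (K : 𝔥 → B) (h0 : K 0 = 1)
    (hk : ∀ h h', K h * K h' = K (h + h'))
    (hE : ∀ h i, K h * E i = qpow η (D.root i h) • (E i * K h))
    (hF : ∀ h i, K h * F i = qpow η (-D.root i h) • (F i * K h))
    (hEF : ∀ i, E i * F i - sgn (D.parity i * D.parity i) • (F i * E i) =
      (qdiff η)⁻¹ • (K (D.simpleH i) - K (-D.simpleH i)))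
    (hne : ∀ i j, i ≠ j → E i * F j - sgn (D.parity i * D.parity j) • (F j * E i) = 0) :
    PreU η D →ₐ[ℂ] B :=
  RingQuot.liftAlgHom ℂ ⟨FreeAlgebra.lift ℂ (fun g => match g with
    | .e i => E i
    | .f i => F i
    | .k h => K h), by
      intro x y hxy
      cases hxy with
      | k_zero => simpa using h0
      | k_add h h' => simpa using hk h h'
      | k_e h i => simpa using hE h i
      | k_f h i => simpa using hF h i
      | e_f_same i => simpa using hEF i
      | e_f_ne i j hij => simpa using hne i j hij⟩

section lift

variable {η D} {B : Type*} [Ring B] [Algebra ℂ B] (E F : ι → B) (K : 𝔥 → B) (h0 : K 0 = 1)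
    (hk : ∀ h h', K h * K h' = K (h + h'))
    (hE : ∀ h i, K h * E i = qpow η (D.root i h) • (E i * K h))
    (hF : ∀ h i, K h * F i = qpow η (-D.root i h) • (F i * K h))
    (hEF : ∀ i, E i * F i - sgn (D.parity i * D.parity i) • (F i * E i) =
      (qdiff η)⁻¹ • (K (D.simpleH i) - K (-D.simpleH i)))
    (hne : ∀ i j, i ≠ j → E i * F j - sgn (D.parity i * D.parity j) • (F j * E i) = 0)

theorem lift_mk (g : Gen ι 𝔥) :
    lift E F K h0 hk hE hF hEF hne (mk η D (FreeAlgebra.ι ℂ g)) = (match g with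
    | .e i => E i
    | .f i => F i
    | .k h => K h) := by
  have h := RingQuot.liftAlgHom_mkAlgHom_apply (S := ℂ) (s := Rel η D)
    (FreeAlgebra.lift ℂ (fun g : Gen ι 𝔥 => match g with
    | .e i => E i
    | .f i => F i
    | .k h => K h)) (by
      intro x y hxy
      cases hxy with
      | k_zero => simpa using h0
      | k_add h h' => simpa using hk h h'
      | k_e h i => simpa using hE h i
      | k_f h i => simpa using hF h i
      | e_f_same i => simpa using hEF i
      | e_f_ne i j hij => simpa using hne i j hij) (FreeAlgebra.ι ℂ g)
  exact h.trans (FreeAlgebra.lift_ι_apply _ _)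

theorem lift_e (i : ι) : lift E F K h0 hk hE hF hEF hne (e η D i) = E i :=
  lift_mk E F K h0 hk hE hF hEF hne (.e i)

theorem lift_f (i : ι) : lift E F K h0 hk hE hF hEF hne (f η D i) = F i :=
  lift_mk E F K h0 hk hE hF hEF hne (.f i)

theorem lift_k (h : 𝔥) : lift E F K h0 hk hE hF hEF hne (k η D h) = K h :=
  lift_mk E F K h0 hk hE hF hEF hne (.k h)

end lift

variable {η D} in
theorem algHom_ext {B : Type*} [Ring B] [Algebra ℂ B] {φ ψ : PreU η D →ₐ[ℂ] B}
    (he : ∀ i, φ (e η D i) = ψ (e η D i)) (hf : ∀ i, φ (f η D i) = ψ (f η D i))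
    (hk : ∀ h, φ (k η D h) = ψ (k η D h)) : φ = ψ := by
  refine RingQuot.ringQuot_ext' ℂ _ _ (FreeAlgebra.hom_ext (funext fun g => ?_))
  cases g with
  | e i => exact he i
  | f i => exact hf i
  | k h => exact hk h

/-- The parity automorphism: `e i ↦ (-1)^[i] e i`, `f i ↦ (-1)^[i] f i`, `k h ↦ k h`. -/
def par : PreU η D →ₐ[ℂ] PreU η D :=
  lift (fun i => sgn (D.parity i) • e η D i) (fun i => sgn (D.parity i) • f η D i) (k η D)
    (k_zero η D) (k_mul η D)
    (by
      intro h i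
      rw [mul_smul_comm, smul_mul_assoc, k_e, smul_comm])
    (by
      intro h i
      rw [mul_smul_comm, smul_mul_assoc, k_f, smul_comm])
    (by
      intro i
      rw [smul_mul_smul_comm, smul_mul_smul_comm, sgn_mul_self, one_smul, one_smul, e_f_same])
    (by
      intro i j hij
      rw [smul_mul_smul_comm, smul_mul_smul_comm, smul_comm, mul_comm (sgn (D.parity j)),
        ← smul_sub, e_f_ne η D i j hij, smul_zero])

theorem par_e (i : ι) : par η D (e η D i) = sgn (D.parity i) • e η D i := lift_e ..

theorem par_f (i : ι) : par η D (f η D i) = sgn (D.parity i) • f η D i := lift_f ..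

theorem par_k (h : 𝔥) : par η D (k η D h) = k η D h := lift_k ..

theorem par_par (a : PreU η D) : par η D (par η D a) = a := by
  have h : (par η D).comp (par η D) = AlgHom.id ℂ _ := by
    refine algHom_ext (fun i => ?_) (fun i => ?_) (fun h => ?_)
    · simp [par_e, smul_smul, sgn_mul_self]
    · simp [par_f, smul_smul, sgn_mul_self]
    · simp [par_k]
  exact DFunLike.congr_fun h a

/-- The `ℤ/2`-grading. -/
def gr : ZMod 2 → Submodule ℂ (PreU η D) := parityPart (par η D)

instance : GradedAlgebra (gr η D) := parityGraded (par η D) (par_par η D)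

theorem e_mem (i : ι) : e η D i ∈ gr η D (D.parity i) := par_e η D i

theorem f_mem (i : ι) : f η D i ∈ gr η D (D.parity i) := par_f η D i

theorem k_mem (h : 𝔥) : k η D h ∈ gr η D 0 := by
  have h1 := par_k η D h
  rw [← one_smul ℂ (k η D h), ← sgn_zero] at h1
  rw [gr, mem_parityPart]
  simpa [sgn_zero] using h1

variable {η D} in
theorem tmul_mul {s t : ZMod 2} (a : PreU η D) {b c : PreU η D} (d : PreU η D)
    (hb : b ∈ gr η D s) (hc : c ∈ gr η D t) :
    ((a ᵍ⊗ₜ[ℂ] b : gr η D ᵍ⊗[ℂ] gr η D) * (c ᵍ⊗ₜ[ℂ] d : gr η D ᵍ⊗[ℂ] gr η D)) =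
      sgn (s * t) • ((a * c) ᵍ⊗ₜ[ℂ] (b * d)) := by
  have h := GradedTensorProduct.tmul_coe_mul_coe_tmul (R := ℂ) (gr η D) (gr η D) a ⟨b, hb⟩
    ⟨c, hc⟩ d
  rw [units_smul_eq_sgn] at h
  exact h

section tmul

variable {A : Type*} [Ring A] [Algebra ℂ A] {𝒜 : ZMod 2 → Submodule ℂ A} [GradedAlgebra 𝒜]

theorem smul_gtmul (c : ℂ) (a b : A) :
    ((c • a) ᵍ⊗ₜ[ℂ] b : 𝒜 ᵍ⊗[ℂ] 𝒜) = c • (a ᵍ⊗ₜ[ℂ] b) := by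
  rw [GradedTensorProduct.tmul, ← TensorProduct.smul_tmul', map_smul]

theorem gtmul_smul (c : ℂ) (a b : A) :
    (a ᵍ⊗ₜ[ℂ] (c • b) : 𝒜 ᵍ⊗[ℂ] 𝒜) = c • (a ᵍ⊗ₜ[ℂ] b) := by
  simp [GradedTensorProduct.tmul, TensorProduct.tmul_smul]

theorem sub_gtmul (a a' b : A) :
    ((a - a') ᵍ⊗ₜ[ℂ] b : 𝒜 ᵍ⊗[ℂ] 𝒜) = a ᵍ⊗ₜ[ℂ] b - a' ᵍ⊗ₜ[ℂ] b := by
  simp [GradedTensorProduct.tmul, TensorProduct.sub_tmul]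

theorem gtmul_sub (a b b' : A) :
    (a ᵍ⊗ₜ[ℂ] (b - b') : 𝒜 ᵍ⊗[ℂ] 𝒜) = a ᵍ⊗ₜ[ℂ] b - a ᵍ⊗ₜ[ℂ] b' := by
  simp [GradedTensorProduct.tmul, TensorProduct.tmul_sub]

end tmul

/-- `q ^ (h_i / 2)`. -/
def kp (i : ι) : PreU η D := k η D ((1 / 2 : ℂ) • D.simpleH i)

/-- `q ^ (-h_i / 2)`. -/
def km (i : ι) : PreU η D := k η D ((-1 / 2 : ℂ) • D.simpleH i)

theorem k_e_same (h : 𝔥) (x : ι → PreU η D) (s : ι → ZMod 2) (c : ℂ) (i : ι)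
    (hx : x i ∈ gr η D (s i)) (hk : k η D h * x i = c • (x i * k η D h)) :
    (k η D h ᵍ⊗ₜ[ℂ] k η D h : gr η D ᵍ⊗[ℂ] gr η D) *
        (kp η D i ᵍ⊗ₜ[ℂ] x i + x i ᵍ⊗ₜ[ℂ] km η D i) =
      c • ((kp η D i ᵍ⊗ₜ[ℂ] x i + x i ᵍ⊗ₜ[ℂ] km η D i) *
        (k η D h ᵍ⊗ₜ[ℂ] k η D h : gr η D ᵍ⊗[ℂ] gr η D)) := by
  have hp : kp η D i ∈ gr η D 0 := k_mem η D _
  have hm : km η D i ∈ gr η D 0 := k_mem η D _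
  rw [mul_add, add_mul, tmul_mul _ _ (k_mem η D h) hp,
    tmul_mul _ _ (k_mem η D h) hx, tmul_mul _ _ hx (k_mem η D h),
    tmul_mul _ _ hm (k_mem η D h), hk]
  simp only [mul_zero, zero_mul, sgn_zero, one_smul, smul_gtmul, gtmul_smul, smul_add, kp, km,
    k_mul, add_comm h]

theorem k_comm_e (i j : ι) (c : ℂ) :
    k η D (c • D.simpleH j) * e η D i =
      qpow η (c * D.root i (D.simpleH j)) • (e η D i * k η D (c • D.simpleH j)) := by
  rw [k_e, map_smul, smul_eq_mul]

theorem k_comm_f (i j : ι) (c : ℂ) :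
    k η D (c • D.simpleH j) * f η D i =
      qpow η (-(c * D.root i (D.simpleH j))) • (f η D i * k η D (c • D.simpleH j)) := by
  rw [k_f, map_smul, smul_eq_mul]

theorem comul_e_f (i j : ι) :
    (kp η D i ᵍ⊗ₜ[ℂ] e η D i + e η D i ᵍ⊗ₜ[ℂ] km η D i : gr η D ᵍ⊗[ℂ] gr η D) *
        (kp η D j ᵍ⊗ₜ[ℂ] f η D j + f η D j ᵍ⊗ₜ[ℂ] km η D j) -
      sgn (D.parity i * D.parity j) •
        ((kp η D j ᵍ⊗ₜ[ℂ] f η D j + f η D j ᵍ⊗ₜ[ℂ] km η D j : gr η D ᵍ⊗[ℂ] gr η D) *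
          (kp η D i ᵍ⊗ₜ[ℂ] e η D i + e η D i ᵍ⊗ₜ[ℂ] km η D i)) =
    (kp η D i * kp η D j) ᵍ⊗ₜ[ℂ] (e η D i * f η D j
        - sgn (D.parity i * D.parity j) • (f η D j * e η D i)) +
      (e η D i * f η D j
        - sgn (D.parity i * D.parity j) • (f η D j * e η D i)) ᵍ⊗ₜ[ℂ] (km η D i * km η D j) := by
  have he := e_mem η D
  have hf := f_mem η D
  have hp : ∀ i, kp η D i ∈ gr η D 0 := fun i => k_mem η D _
  have hm : ∀ i, km η D i ∈ gr η D 0 := fun i => k_mem η D _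
  have hpp : kp η D j * kp η D i = kp η D i * kp η D j := by
    simp only [kp, k_mul, add_comm]
  have hmm : km η D j * km η D i = km η D i * km η D j := by
    simp only [km, k_mul, add_comm]
  -- the two mixed terms
  have h1 : ((kp η D i * f η D j) ᵍ⊗ₜ[ℂ] (e η D i * km η D j) : gr η D ᵍ⊗[ℂ] gr η D) =
      (f η D j * kp η D i) ᵍ⊗ₜ[ℂ] (km η D j * e η D i) := by
    rw [kp, km, k_comm_f, k_comm_e, smul_gtmul, gtmul_smul, D.root_simpleH_comm i j]
    congr 2
    ring
  have h2 : ((e η D i * kp η D j) ᵍ⊗ₜ[ℂ] (km η D i * f η D j) : gr η D ᵍ⊗[ℂ] gr η D) =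
      (kp η D j * e η D i) ᵍ⊗ₜ[ℂ] (f η D j * km η D i) := by
    rw [kp, km, k_comm_f, k_comm_e, smul_gtmul, gtmul_smul, D.root_simpleH_comm i j]
    congr 2
    ring
  simp only [mul_add, add_mul]
  rw [tmul_mul _ _ (he i) (hp j), tmul_mul _ _ (he i) (hf j), tmul_mul _ _ (hm i) (hp j),
    tmul_mul _ _ (hm i) (hf j), tmul_mul _ _ (hf j) (hp i), tmul_mul _ _ (hf j) (he i),
    tmul_mul _ _ (hm j) (hp i), tmul_mul _ _ (hm j) (he i), h1, h2, hpp, hmm]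
  simp only [mul_zero, zero_mul, sgn_zero, one_smul, sub_gtmul, gtmul_sub, smul_gtmul,
    gtmul_smul, smul_add, smul_smul, mul_comm (D.parity j), sgn_mul_self]
  abel

/-- The coproduct: `Δ x = q^{h_i/2} ⊗ x + x ⊗ q^{-h_i/2}` for `x = e i, f i`, and
`Δ q^h = q^h ⊗ q^h`. -/
def comul : PreU η D →ₐ[ℂ] gr η D ᵍ⊗[ℂ] gr η D :=
  lift (fun i => kp η D i ᵍ⊗ₜ[ℂ] e η D i + e η D i ᵍ⊗ₜ[ℂ] km η D i)
    (fun i => kp η D i ᵍ⊗ₜ[ℂ] f η D i + f η D i ᵍ⊗ₜ[ℂ] km η D i)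
    (fun h => k η D h ᵍ⊗ₜ[ℂ] k η D h)
    (by rw [k_zero]; rfl)
    (by
      intro h h'
      rw [tmul_mul _ _ (k_mem η D h) (k_mem η D h'), k_mul]
      simp [sgn_zero])
    (fun h i => k_e_same η D h (e η D) D.parity _ i (e_mem η D i) (k_e η D h i))
    (fun h i => k_e_same η D h (f η D) D.parity _ i (f_mem η D i) (k_f η D h i))
    (by
      intro i
      have hp : kp η D i * kp η D i = k η D (D.simpleH i) := by
        rw [kp, k_mul, ← add_smul]; norm_num
      have hm : km η D i * km η D i = k η D (-D.simpleH i) := by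
        rw [km, k_mul, ← add_smul]; norm_num
      rw [comul_e_f, e_f_same, hp, hm, smul_gtmul, gtmul_smul, sub_gtmul, gtmul_sub,
        ← smul_add]
      congr 1
      abel)
    (by
      intro i j hij
      rw [comul_e_f, e_f_ne η D i j hij]
      simp [GradedTensorProduct.tmul])

/-- The counit. -/
def counit : PreU η D →ₐ[ℂ] ℂ :=
  lift (fun _ => 0) (fun _ => 0) (fun _ => 1) rfl (by simp) (by simp) (by simp) (by simp)
    (by simp)

/-- `I ⊗ A + A ⊗ I` inside `A ⊗ A`. -/
def coidealSpan (I : Submodule ℂ (PreU η D)) : Submodule ℂ (gr η D ᵍ⊗[ℂ] gr η D) :=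
  Submodule.span ℂ {t | ∃ a b, (a ∈ I ∨ b ∈ I) ∧ t = a ᵍ⊗ₜ[ℂ] b}

/-- Graded bi-ideals that meet the span of the `q^h`, `h ∈ 𝔥`, trivially. -/
structure IsSerreIdeal (I : Submodule ℂ (PreU η D)) : Prop where
  mul_left : ∀ a, ∀ x ∈ I, a * x ∈ I
  mul_right : ∀ a, ∀ x ∈ I, x * a ∈ I
  graded : ∀ x ∈ I, par η D x ∈ I
  comul : ∀ x ∈ I, comul η D x ∈ coidealSpan η D I
  counit : ∀ x ∈ I, counit η D x = 0
  cartan : ∀ x ∈ I, x ∈ Submodule.span ℂ (Set.range (k η D)) → x = 0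

/-- The elements of the graded bi-ideals which meet the Cartan part trivially are set to zero. -/
def SerreRel (x y : PreU η D) : Prop := y = 0 ∧ ∃ I, IsSerreIdeal η D I ∧ x ∈ I

end PreU

/-- The quantum supergroup with `q = exp η`: the quotient of the Hopf superalgebra with generators
`e i`, `f i`, `q^h` by its largest graded Hopf ideal which meets the Cartan part trivially.  (For
generic `q` this ideal is generated by the quantum Serre relations.) -/
def Uq : Type _ := RingQuot (PreU.SerreRel η D)

instance : Ring (Uq η D) := inferInstanceAs (Ring (RingQuot (PreU.SerreRel η D)))

instance : Algebra ℂ (Uq η D) := inferInstanceAs (Algebra ℂ (RingQuot (PreU.SerreRel η D)))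

namespace Uq

def proj : PreU η D →ₐ[ℂ] Uq η D := RingQuot.mkAlgHom ℂ (PreU.SerreRel η D)

theorem proj_surjective : Function.Surjective (proj η D) := RingQuot.mkAlgHom_surjective ℂ _

theorem proj_eq_zero {I : Submodule ℂ (PreU η D)} (hI : PreU.IsSerreIdeal η D I) {x : PreU η D}
    (hx : x ∈ I) : proj η D x = 0 := by
  have h := RingQuot.mkAlgHom_rel ℂ (s := PreU.SerreRel η D) (x := x) (y := 0)
    ⟨rfl, I, hI, hx⟩
  rw [map_zero] at h
  exact h

variable {η D} in
def lift {B : Type*} [Ring B] [Algebra ℂ B] (φ : PreU η D →ₐ[ℂ] B)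
    (hφ : ∀ I, PreU.IsSerreIdeal η D I → ∀ x ∈ I, φ x = 0) : Uq η D →ₐ[ℂ] B :=
  RingQuot.liftAlgHom ℂ ⟨φ, by
    rintro x y ⟨rfl, I, hI, hx⟩
    rw [hφ I hI x hx, map_zero]⟩

variable {η D} in
theorem lift_proj {B : Type*} [Ring B] [Algebra ℂ B] (φ : PreU η D →ₐ[ℂ] B)
    (hφ : ∀ I, PreU.IsSerreIdeal η D I → ∀ x ∈ I, φ x = 0) (x : PreU η D) :
    lift φ hφ (proj η D x) = φ x :=
  RingQuot.liftAlgHom_mkAlgHom_apply ℂ φ _ x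

def e (i : ι) : Uq η D := proj η D (PreU.e η D i)

def f (i : ι) : Uq η D := proj η D (PreU.f η D i)

/-- `q ^ h`. -/
def k (h : 𝔥) : Uq η D := proj η D (PreU.k η D h)

/-- The parity automorphism `a ↦ (-1)^[a] a`. -/
def par : Uq η D →ₐ[ℂ] Uq η D :=
  lift ((proj η D).comp (PreU.par η D)) fun _ hI _ hx => proj_eq_zero η D hI (hI.graded _ hx)

theorem par_proj (x : PreU η D) : par η D (proj η D x) = proj η D (PreU.par η D x) :=
  lift_proj ..

theorem par_par (a : Uq η D) : par η D (par η D a) = a := by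
  obtain ⟨x, rfl⟩ := proj_surjective η D a
  rw [par_proj, par_proj, PreU.par_par]

/-- The `ℤ/2`-grading. -/
def gr : ZMod 2 → Submodule ℂ (Uq η D) := parityPart (par η D)

instance : GradedAlgebra (gr η D) := parityGraded (par η D) (par_par η D)

theorem proj_mem {s : ZMod 2} {x : PreU η D} (hx : x ∈ PreU.gr η D s) :
    proj η D x ∈ gr η D s := by
  have h : PreU.par η D x = sgn s • x := hx
  rw [gr, mem_parityPart, par_proj, h, map_smul]

/-- The map `proj ⊗ proj` of graded tensor products. -/
def projTensor : PreU.gr η D ᵍ⊗[ℂ] PreU.gr η D →ₐ[ℂ] gr η D ᵍ⊗[ℂ] gr η D :=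
  GradedTensorProduct.lift (PreU.gr η D) (PreU.gr η D)
    ((GradedTensorProduct.includeLeft (gr η D) (gr η D)).comp (proj η D))
    ((GradedTensorProduct.includeRight (gr η D) (gr η D)).comp (proj η D))
    (by
      intro i j a b
      have h := GradedTensorProduct.tmul_coe_mul_coe_tmul (R := ℂ) (gr η D) (gr η D) 1
        ⟨_, proj_mem η D b.2⟩ ⟨_, proj_mem η D a.2⟩ 1
      rw [one_mul, mul_one] at h
      simp only [AlgHom.comp_apply, GradedTensorProduct.includeLeft_apply,
        GradedTensorProduct.includeRight_apply]
      rw [GradedTensorProduct.tmul_one_mul_one_tmul, h, smul_smul, Int.units_mul_self, one_smul])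

theorem projTensor_tmul (a b : PreU η D) :
    projTensor η D (a ᵍ⊗ₜ[ℂ] b) = proj η D a ᵍ⊗ₜ[ℂ] proj η D b := by
  rw [projTensor, GradedTensorProduct.lift_tmul]
  simp only [AlgHom.comp_apply, GradedTensorProduct.includeLeft_apply,
        GradedTensorProduct.includeRight_apply]
  rw [GradedTensorProduct.tmul_one_mul_one_tmul]

theorem projTensor_coidealSpan {I : Submodule ℂ (PreU η D)} (hI : PreU.IsSerreIdeal η D I)
    {t : PreU.gr η D ᵍ⊗[ℂ] PreU.gr η D} (ht : t ∈ PreU.coidealSpan η D I) :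
    projTensor η D t = 0 := by
  have h : PreU.coidealSpan η D I ≤ LinearMap.ker (projTensor η D).toLinearMap := by
    refine Submodule.span_le.2 ?_
    rintro _ ⟨a, b, hab, rfl⟩
    rw [SetLike.mem_coe, LinearMap.mem_ker, AlgHom.toLinearMap_apply, projTensor_tmul]
    rcases hab with ha | hb
    · rw [proj_eq_zero η D hI ha]; simp [GradedTensorProduct.tmul]
    · rw [proj_eq_zero η D hI hb]; simp [GradedTensorProduct.tmul]
  exact h ht

/-- The coproduct of the quantum supergroup. -/
def comul : Uq η D →ₐ[ℂ] gr η D ᵍ⊗[ℂ] gr η D :=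
  lift ((projTensor η D).comp (PreU.comul η D)) fun _ hI _ hx =>
    projTensor_coidealSpan η D hI (hI.comul _ hx)

/-- The super twist `a ⊗ b ↦ (-1)^{[a][b]} b ⊗ a`. -/
def twist : gr η D ᵍ⊗[ℂ] gr η D →ₐ[ℂ] gr η D ᵍ⊗[ℂ] gr η D :=
  (GradedTensorProduct.comm (gr η D) (gr η D)).toAlgHom

/-- The opposite coproduct. -/
def comulOp : Uq η D →ₐ[ℂ] gr η D ᵍ⊗[ℂ] gr η D := (twist η D).comp (comul η D)

/-- The part of weight `-ν` of the subalgebra generated by the `f i` and the `q^h`; a multiset `ν`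
of indices stands for the sum of the corresponding simple roots. -/
def lowerPart (ν : Multiset ι) : Submodule ℂ (Uq η D) :=
  Submodule.span ℂ {x | ∃ (w : List ι) (h : 𝔥), (w : Multiset ι) = ν ∧
    x = (w.map (f η D)).prod * k η D h}

/-- The part of weight `ν` of the subalgebra generated by the `e i` and the `q^h`. -/
def upperPart (ν : Multiset ι) : Submodule ℂ (Uq η D) :=
  Submodule.span ℂ {x | ∃ (w : List ι) (h : 𝔥), (w : Multiset ι) = ν ∧
    x = (w.map (e η D)).prod * k η D h}

end Uq

/-! ### Representations -/

/-- A representation on a finite-dimensional weight supermodule, in a homogeneous basis of weight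
vectors. -/
structure Rep (n : ℕ) where
  mat : Uq η D →ₐ[ℂ] Matrix (Fin n) (Fin n) ℂ
  /-- The parities of the basis vectors. -/
  parity : Fin n → ZMod 2
  /-- The weights of the basis vectors. -/
  weight : Fin n → Module.Dual ℂ 𝔥
  mat_par : ∀ a α β, mat (Uq.par η D a) α β = sgn (parity α + parity β) * mat a α β
  mat_k : ∀ h, mat (Uq.k η D h) = Matrix.diagonal fun α => qpow η (weight α h)

variable {η D}

namespace Rep

/-- The representation is irreducible. -/
def IsIrreducible {n : ℕ} (π : Rep η D n) : Prop :=
  n ≠ 0 ∧ ∀ W : Submodule ℂ (Fin n → ℂ), (∀ a, ∀ v ∈ W, (π.mat a).mulVec v ∈ W) → W = ⊥ ∨ W = ⊤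

/-- The representation has a maximal weight vector, of weight `Λ`. -/
def HasHighestWeight {n : ℕ} (π : Rep η D n) (Λ : Module.Dual ℂ 𝔥) : Prop :=
  ∃ v : Fin n → ℂ, v ≠ 0 ∧ (∀ i, (π.mat (Uq.e η D i)).mulVec v = 0) ∧
    ∀ h, (π.mat (Uq.k η D h)).mulVec v = qpow η (Λ h) • v

/-- `y ↦ (-1)^{[y] s} y`. -/
def signed (s : ZMod 2) : Uq η D →ₗ[ℂ] Uq η D :=
  if s = 0 then LinearMap.id else (Uq.par η D).toLinearMap

/-- For `κ : X → End V`, where `V` has a basis `v_α` with parities `p α`, the matrix over the quantum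
supergroup of the operator `κ x ⊗ y`.  The entries of the matrix `M` of an operator `B` are
defined by `B (v_β ⊗ w) = ∑ v_α ⊗ M α β w`. -/
def entries {X I : Type*} [AddCommGroup X] [Module ℂ X] (κ : X →ₗ[ℂ] Matrix I I ℂ)
    (p : I → ZMod 2) : X ⊗[ℂ] Uq η D →ₗ[ℂ] Matrix I I (Uq η D) :=
  TensorProduct.lift (LinearMap.mk₂ ℂ
    (fun x y => Matrix.of fun α β => κ x α β • signed (p β) y)
    (by intro x x' y; ext; simp [add_smul])
    (by intro c x y; ext; simp [mul_smul])
    (by intro x y y'; ext; simp [smul_add])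
    (by intro c x y; ext; simp only [map_smul, Matrix.of_apply, Matrix.smul_apply, smul_comm c]))

variable {n m : ℕ} (π : Rep η D n) (τ : Rep η D m)

/-- `(π ⊗ id) t`. -/
def act (t : Uq.gr η D ᵍ⊗[ℂ] Uq.gr η D) : Matrix (Fin n) (Fin n) (Uq η D) :=
  entries π.mat.toLinearMap π.parity ((GradedTensorProduct.of ℂ _ _).symm t)

/-- `(π ⊗ id) q^{∑ h_i ⊗ h^i}`, where `h_i` and `h^i` are dual bases of `𝔥`: on a vector of
weight `λ` this is `q^{h_λ}`. -/
def cartanMat : Matrix (Fin n) (Fin n) (Uq η D) :=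
  Matrix.diagonal fun α => Uq.k η D (D.dualVec (π.weight α))

/-- `(π ⊗ id) R` for the formal series `R = q^{∑ h_i ⊗ h^i} ∑_ν θ ν`. -/
def imR (θ : Multiset ι → Uq.gr η D ᵍ⊗[ℂ] Uq.gr η D) : Matrix (Fin n) (Fin n) (Uq η D) :=
  π.cartanMat * ∑ᶠ ν, π.act (θ ν)

/-- `(π ⊗ id) Rᵀ` for the formal series `R = q^{∑ h_i ⊗ h^i} ∑_ν θ ν`. -/
def imRT (θ : Multiset ι → Uq.gr η D ᵍ⊗[ℂ] Uq.gr η D) : Matrix (Fin n) (Fin n) (Uq η D) :=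
  π.cartanMat * ∑ᶠ ν, π.act (Uq.twist η D (θ ν))

/-- `(π ⊗ τ) (a ⊗ b)`. -/
def kron : (Uq η D ⊗[ℂ] Uq η D) →ₗ[ℂ] Matrix (Fin n × Fin m) (Fin n × Fin m) ℂ :=
  TensorProduct.lift (LinearMap.mk₂ ℂ
    (fun a b => Matrix.of fun x y => sgn ((τ.parity x.2 + τ.parity y.2) * π.parity y.1) *
      (π.mat a x.1 y.1 * τ.mat b x.2 y.2))
    (by intro a a' b; ext; simp; ring)
    (by intro c a b; ext; simp; ring)
    (by intro a b b'; ext; simp; ring)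
    (by intro c a b; ext; simp; ring))

/-- `(π ⊗ τ ⊗ id) (Δ ⊗ id) R` for the formal series `R = q^{∑ h_i ⊗ h^i} ∑_ν θ ν`. -/
def imComulR (θ : Multiset ι → Uq.gr η D ᵍ⊗[ℂ] Uq.gr η D) :
    Matrix (Fin n × Fin m) (Fin n × Fin m) (Uq η D) :=
  (Matrix.diagonal fun x => Uq.k η D (D.dualVec (π.weight x.1 + τ.weight x.2))) *
    ∑ᶠ ν, entries (kron π τ ∘ₗ (GradedTensorProduct.of ℂ _ _).symm.toLinearMap ∘ₗ
        (Uq.comul η D).toLinearMap)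
      (fun x => π.parity x.1 + τ.parity x.2) ((GradedTensorProduct.of ℂ _ _).symm (θ ν))

/-- `(π ⊗ τ ⊗ id) R₁₃`. -/
def imR13 (θ : Multiset ι → Uq.gr η D ᵍ⊗[ℂ] Uq.gr η D) :
    Matrix (Fin n × Fin m) (Fin n × Fin m) (Uq η D) :=
  Matrix.of fun x y => if x.2 = y.2 then signed (τ.parity y.2) (π.imR θ x.1 y.1) else 0

/-- `(π ⊗ τ ⊗ id) R₂₃`. -/
def imR23 (n : ℕ) (τ : Rep η D m) (θ : Multiset ι → Uq.gr η D ᵍ⊗[ℂ] Uq.gr η D) :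
    Matrix (Fin n × Fin m) (Fin n × Fin m) (Uq η D) :=
  Matrix.of fun x y => if x.1 = y.1 then τ.imR θ x.2 y.2 else 0

end Rep

variable (η D)

/-- A universal `R`-matrix `R = q^{∑ h_i ⊗ h^i} (1 ⊗ 1 + ⋯)`.  It is a formal series in the
components `θ ν`, with lower first and upper second tensor factors.  Identities between such
series are imposed on the image under every finite-dimensional weight representation of one
tensor factor (of two in `comul_left`), where the series become finite. -/
structure UniversalRMatrix where
  θ : Multiset ι → Uq.gr η D ᵍ⊗[ℂ] Uq.gr η D
  θ_zero : θ 0 = 1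
  θ_mem : ∀ ν, θ ν ∈ Submodule.span ℂ
    {t | ∃ x ∈ Uq.lowerPart η D ν, ∃ y ∈ Uq.upperPart η D ν, t = x ᵍ⊗ₜ[ℂ] y}
  /-- `R Δ(a) = Δᵀ(a) R`, represented on the first factor. -/
  intertwine : ∀ {n : ℕ} (π : Rep η D n) (a : Uq η D),
    π.imR θ * π.act (Uq.comul η D a) = π.act (Uq.comulOp η D a) * π.imR θ
  /-- `R Δ(a) = Δᵀ(a) R`, represented on the second factor. -/
  intertwine_op : ∀ {n : ℕ} (π : Rep η D n) (a : Uq η D),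
    π.imRT θ * π.act (Uq.comulOp η D a) = π.act (Uq.comul η D a) * π.imRT θ
  /-- `(Δ ⊗ id) R = R₁₃ R₂₃`. -/
  comul_left : ∀ {n m : ℕ} (π : Rep η D n) (τ : Rep η D m),
    π.imComulR τ θ = π.imR13 τ θ * Rep.imR23 n τ θ
  /-- `(id ⊗ Δ) R = R₁₃ R₁₂`. -/
  comul_right : ∀ {n : ℕ} (π : Rep η D n) (α β : Fin n),
    Uq.comul η D (π.imR θ α β) =
      ∑ γ, (1 ᵍ⊗ₜ[ℂ] π.imR θ α γ) * (π.imR θ γ β ᵍ⊗ₜ[ℂ] 1)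

variable {η D}

namespace Rep

variable {n : ℕ} (π : Rep η D n) (R : UniversalRMatrix η D)

/-- The characteristic matrix `A = (q - q⁻¹)⁻¹ (π ⊗ id) (1 - Rᵀ R)`. -/
def charMatrix : Matrix (Fin n) (Fin n) (Uq η D) :=
  (qdiff η)⁻¹ • (1 - π.imRT R.θ * π.imR R.θ)

/-- The supertrace over the representation space. -/
def str (M : Matrix (Fin n) (Fin n) (Uq η D)) : Uq η D := ∑ α, sgn (π.parity α) • M α α

/-- `str (q^{2 h_ρ} A^m)`. -/
def invariant (ρ : Module.Dual ℂ 𝔥) (m : ℕ) : Uq η D :=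
  π.str ((π.mat (Uq.k η D ((2 : ℂ) • D.dualVec ρ))).map (algebraMap ℂ (Uq η D)) *
    π.charMatrix R ^ m)

end Rep

end Quantum

end QSuper

end

/-! The proof joins a fact about quantum supertraces to a fact about `ρ`.

Quantum side. From `R Δ(a) = Δᵀ(a) R` and its transpose, `Rᵀ R` commutes with `Δ(a)`; hence `A`, and
every power `B` of it, commutes with `(π ⊗ id) Δ(a)` (`commute_charMatrix`). For such `B` it
suffices to commute `str (q^{2 h_ρ} B)` past generators. For `q^h` this only says that the diagonal
entries of `B` have weight zero. A generator `u = e_i` or `f_i` has `Δ u = q^c ⊗ u + u ⊗ q^{-c}`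
with `c = h_i / 2`. The diagonal entries of `B Δ(u) = Δ(u) B`, summed with weights that turn the
coefficient of the first term into `(-1)^[α] q^{2(ρ, λ_α)}`, give the wanted commutation plus two
double sums from `u ⊗ q^{-c}`. Exchanging the two indices matches these sums exactly when `q^{2 h_ρ
- 2c} = q^{2 h_ρ - h_i}` commutes with `u` (`commute_quantumStr`). So what is needed is `2 (ρ, α_i)
= (α_i, α_i)`.

Classical side (`root_two_rho`). Reflections in odd roots are not available, so the identity is
obtained from a supertrace. The number `2 ρ(h_i)` is the sum of `(-1)^s β(h_i) dim L_{β,s}` over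
positive weights `β` and parities `s`. Split the positive weights into multiples of `α_i` and the
rest.

The rest is stable under adding or subtracting `α_i` as long as one stays among weights of `L`, so
its contribution is the supertrace of `ad [e_i, f_i]` on an `ad e_i`, `ad f_i`-stable space, which
is zero (`finsum_transverse`).

Among the multiples only `α_i` and `2 α_i` can occur. If `α_i` is even, then `[e_i, e_i] = 0` and
the contribution is `α_i(h_i)`. If it is odd and `α_i(h_i) ≠ 0`, then `[e_i, e_i] ≠ 0` and the
contribution is `-α_i(h_i) + 2 α_i(h_i)`. If `α_i(h_i) = 0`, both sides vanish
(`finsum_nsmul_root`).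

That all weights are positive, negative or zero, and that multiples of `α_i` come only from brackets
of `e_i`, follows from `triangular_decomposition` and the independence of the simple roots. -/

noncomputable section

namespace QSuper

/-! ### Operators acting by scalars on the summands of a direct sum -/

section Scalar

variable {κ V : Type*} [DecidableEq κ] [AddCommGroup V] [Module ℂ V]

/-- The operator that acts on the summand `N i` of an internal direct sum as the scalar `g i`. -/
def scalarOn {N : κ → Submodule ℂ V} (hN : DirectSum.IsInternal N) (g : κ → ℂ) : V →ₗ[ℂ] V :=
  DirectSum.toModule ℂ κ V (fun i => g i • (N i).subtype) ∘ₗ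
    (LinearEquiv.ofBijective (DirectSum.coeLinearMap N) hN).symm.toLinearMap

theorem scalarOn_apply {N : κ → Submodule ℂ V} (hN : DirectSum.IsInternal N) (g : κ → ℂ) {i : κ}
    {x : V} (hx : x ∈ N i) : scalarOn hN g x = g i • x := by
  have h : (LinearEquiv.ofBijective (DirectSum.coeLinearMap N) hN).symm x =
      DirectSum.lof ℂ κ (fun i => N i) i ⟨x, hx⟩ := by
    rw [LinearEquiv.symm_apply_eq]
    exact (DirectSum.coeLinearMap_lof N i ⟨x, hx⟩).symm
  rw [scalarOn, LinearMap.comp_apply, LinearEquiv.coe_coe, h, DirectSum.toModule_lof]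
  rfl

theorem linearMap_ext_of_isInternal {W : Type*} [AddCommGroup W] [Module ℂ W]
    {N : κ → Submodule ℂ V} (hN : DirectSum.IsInternal N) {S T : V →ₗ[ℂ] W}
    (h : ∀ i, ∀ x ∈ N i, S x = T x) : S = T := by
  have htop : (⊤ : Submodule ℂ V) ≤ LinearMap.eqLocus S T := by
    rw [← hN.submodule_iSup_eq_top]
    exact iSup_le fun i x hx => h i x hx
  exact LinearMap.ext fun x => htop (Submodule.mem_top (x := x))

/-- This turns a trace into a sum over weights counted with multiplicity, the form in which `ρ` is
defined. By finite-dimensionality only finitely many summands are nonzero, so the `finsum` does not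
take its default value. -/
theorem trace_scalarOn [FiniteDimensional ℂ V] {N : κ → Submodule ℂ V}
    (hN : DirectSum.IsInternal N) (g : κ → ℂ) :
    LinearMap.trace ℂ V (scalarOn hN g) = ∑ᶠ i, g i * Module.finrank ℂ (N i) := by
  have hmaps : ∀ i, Set.MapsTo (scalarOn hN g) (N i) (N i) := fun i x hx => by
    rw [SetLike.mem_coe, scalarOn_apply hN g hx]
    exact (N i).smul_mem _ hx
  have hfin : {i | N i ≠ ⊥}.Finite :=
    WellFoundedGT.finite_ne_bot_of_iSupIndep hN.submodule_iSupIndep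
  rw [LinearMap.trace_eq_sum_trace_restrict' hN hfin hmaps,
    finsum_eq_sum_of_support_subset (s := hfin.toFinset)]
  · refine Finset.sum_congr rfl fun i _ => ?_
    have h : (scalarOn hN g).restrict (hmaps i) = g i • LinearMap.id := by
      ext x
      exact scalarOn_apply hN g x.2
    rw [h, map_smul, LinearMap.trace_id, smul_eq_mul]
  · intro i hi
    rw [Set.Finite.coe_toFinset]
    intro hbot
    refine hi ?_
    have h : Module.finrank ℂ (N i) = 0 := by rw [hbot]; exact finrank_bot ℂ V
    simp [h]

end Scalar

namespace BasicLieSuperalgebra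

variable {ι L : Type*} [AddCommGroup L] [Module ℂ L] (S : BasicLieSuperalgebra ι L)

/-! ### Homogeneous weight spaces -/

/-- The weight vectors of weight `p.1` and parity `p.2`. -/
def piece (p : Module.Dual ℂ S.cartan × ZMod 2) : Submodule ℂ L :=
  S.gr p.2 ⊓ S.toLieSuperalgebra.rootSpace S.cartan p.1

variable {S}

theorem mem_piece {p : Module.Dual ℂ S.cartan × ZMod 2} {x : L} :
    x ∈ S.piece p ↔ x ∈ S.gr p.2 ∧ ∀ h : S.cartan, S.br h x = p.1 h • x := Iff.rfl

theorem sgn_injective : Function.Injective sgn := by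
  intro s t h
  rcases zmod_two_cases s with rfl | rfl <;> rcases zmod_two_cases t with rfl | rfl <;>
    first | rfl | (exfalso; norm_num [sgn_zero, sgn_one] at h)

variable (S) in
/-- The parity operator `x ↦ (-1)^[x] x`. -/
def parityOp : L →ₗ[ℂ] L := scalarOn S.isInternal sgn

theorem parityOp_apply {s : ZMod 2} {x : L} (hx : x ∈ S.gr s) : S.parityOp x = sgn s • x :=
  scalarOn_apply S.isInternal sgn hx

theorem parityOp_br_cartan (h : S.cartan) :
    S.parityOp ∘ₗ S.br h = S.br h ∘ₗ S.parityOp := by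
  refine linearMap_ext_of_isInternal S.isInternal fun s x hx => ?_
  have h1 := S.br_mem (S.cartan_even h.2) hx
  rw [zero_add] at h1
  rw [LinearMap.comp_apply, LinearMap.comp_apply, parityOp_apply hx, parityOp_apply h1, map_smul]

theorem exists_add_of_mem (x : L) : ∃ y ∈ S.gr 0, ∃ z ∈ S.gr 1, y + z = x := by
  have h : x ∈ ⨆ s, S.gr s := by rw [S.isInternal.submodule_iSup_eq_top]; trivial
  have h2 : ⨆ s, S.gr s = S.gr 0 ⊔ S.gr 1 := by
    refine le_antisymm (iSup_le fun s => ?_) (sup_le (le_iSup S.gr 0) (le_iSup S.gr 1))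
    rcases zmod_two_cases s with rfl | rfl
    · exact le_sup_left
    · exact le_sup_right
  rw [h2, Submodule.mem_sup] at h
  exact h

/-- The parity operator commutes with `ad H`, so with `y + z` also `y - z` has weight `β`; half the
sum and half the difference show that the even and odd parts are weight vectors. -/
theorem rootSpace_le_iSup_piece (β : Module.Dual ℂ S.cartan) :
    S.toLieSuperalgebra.rootSpace S.cartan β ≤ ⨆ p, S.piece p := by
  intro x hx
  obtain ⟨y, hy, z, hz, rfl⟩ := S.exists_add_of_mem x
  have hs : S.parityOp (y + z) = y - z := by
    rw [map_add, parityOp_apply hy, parityOp_apply hz, sgn_zero, sgn_one]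
    module
  have hx' : ∀ h : S.cartan, S.br h (y - z) = β h • (y - z) := by
    intro h
    have h1 := LinearMap.congr_fun (S.parityOp_br_cartan h) (y + z)
    rw [LinearMap.comp_apply, LinearMap.comp_apply, hs, hx h, map_smul, hs] at h1
    exact h1.symm
  have key : ∀ h : S.cartan, S.br h y = β h • y ∧ S.br h z = β h • z := by
    intro h
    have h1 := hx h
    have h2 := hx' h
    rw [map_add, smul_add] at h1
    rw [map_sub, smul_sub] at h2
    constructor
    · have h3 : (2 : ℂ) • S.br h y = (2 : ℂ) • (β h • y) := by
        linear_combination (norm := module) h1 + h2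
      exact smul_right_injective L two_ne_zero h3
    · have h3 : (2 : ℂ) • S.br h z = (2 : ℂ) • (β h • z) := by
        linear_combination (norm := module) h1 - h2
      exact smul_right_injective L two_ne_zero h3
  refine Submodule.add_mem _ ?_ ?_
  · exact Submodule.mem_iSup_of_mem (β, 0) (mem_piece.2 ⟨hy, fun h => (key h).1⟩)
  · exact Submodule.mem_iSup_of_mem (β, 1) (mem_piece.2 ⟨hz, fun h => (key h).2⟩)

variable (S) in
/-- The commuting operators whose joint eigenspaces are the homogeneous weight spaces. -/
def jointOp : Option S.cartan → Module.End ℂ L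
  | none => S.parityOp
  | some h => S.br h

theorem jointOp_commute (a b : Option S.cartan) : Commute (S.jointOp a) (S.jointOp b) := by
  have hc : ∀ h h' : S.cartan, Commute (S.jointOp (some h)) (S.jointOp (some h')) := by
    intro h h'
    refine LinearMap.ext fun x => ?_
    have h1 : S.br (h : L) (h' : L) = 0 := by
      have h2 : (h' : L) ∈ S.toLieSuperalgebra.rootSpace S.cartan 0 := by
        rw [S.rootSpace_zero]; exact h'.2
      simpa using h2 h
    have h2 := S.jacobi x (S.cartan_even h.2) (S.cartan_even h'.2)
    rw [h1] at h2
    rw [map_zero, LinearMap.zero_apply, zero_add, mul_zero, sgn_zero, one_smul] at h2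
    exact h2
  have hn : ∀ h : S.cartan, Commute (S.jointOp none) (S.jointOp (some h)) := fun h =>
    S.parityOp_br_cartan h
  cases a with
  | none => cases b with
    | none => exact Commute.refl _
    | some h => exact hn h
  | some h => cases b with
    | none => exact (hn h).symm
    | some h' => exact hc h h'

variable (S) in
/-- The joint eigenvalues on a homogeneous weight space. -/
def jointWeight (p : Module.Dual ℂ S.cartan × ZMod 2) : Option S.cartan → ℂ
  | none => sgn p.2
  | some h => p.1 h

theorem jointWeight_injective : Function.Injective S.jointWeight := by
  rintro ⟨β, s⟩ ⟨γ, t⟩ h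
  have h1 : s = t := sgn_injective (congr_fun h none)
  have h2 : β = γ := LinearMap.ext fun x => congr_fun h (some x)
  rw [h1, h2]

-- Distinct pairs of weight and parity give distinct systems of eigenvalues of the commuting
-- operators `jointOp`, whose joint generalized eigenspaces are independent; each piece lies in one
-- of them.
variable (S) in
theorem isInternal_piece [DecidableEq (Module.Dual ℂ S.cartan × ZMod 2)] :
    DirectSum.IsInternal S.piece := by
  refine (DirectSum.isInternal_submodule_iff_iSupIndep_and_iSup_eq_top _).2 ⟨?_, ?_⟩
  · have h : iSupIndep fun χ : Option S.cartan → ℂ =>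
        ⨅ a, (S.jointOp a).maxGenEigenspace (χ a) :=
      Module.End.independent_iInf_maxGenEigenspace_of_forall_mapsTo S.jointOp
        fun a b c => Module.End.mapsTo_maxGenEigenspace_of_comm (S.jointOp_commute b a) c
    refine (h.comp S.jointWeight_injective).mono fun p => le_iInf fun a => ?_
    intro x hx
    have hx' : S.jointOp a x = S.jointWeight p a • x := by
      cases a with
      | none => exact parityOp_apply hx.1
      | some h => exact hx.2 h
    rw [Module.End.mem_maxGenEigenspace]
    refine ⟨1, ?_⟩
    rw [pow_one, LinearMap.sub_apply, LinearMap.smul_apply, Module.End.one_apply, hx', sub_self]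
  · rw [eq_top_iff, ← S.iSup_rootSpace]
    exact iSup_le S.rootSpace_le_iSup_piece

theorem eq_of_mem_piece {p q : Module.Dual ℂ S.cartan × ZMod 2} {x : L} (hx : x ≠ 0)
    (hp : x ∈ S.piece p) (hq : x ∈ S.piece q) : p = q := by
  refine Prod.ext (LinearMap.ext fun h => ?_) (sgn_injective ?_)
  · exact smul_left_injective ℂ hx ((hp.2 h).symm.trans (hq.2 h))
  · exact smul_left_injective ℂ hx ((parityOp_apply hp.1).symm.trans (parityOp_apply hq.1))

theorem mem_piece_zero {x : L} (hx : x ∈ S.cartan) : x ∈ S.piece (0, 0) :=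
  ⟨S.cartan_even hx, by rw [S.rootSpace_zero]; exact hx⟩

theorem e_mem_piece (i : ι) : S.e i ∈ S.piece (S.root i, S.parity i) := ⟨S.e_even i, S.e_root i⟩

theorem f_mem_piece (i : ι) : S.f i ∈ S.piece (-S.root i, S.parity i) := ⟨S.f_even i, S.f_root i⟩

theorem br_mem_piece {p q : Module.Dual ℂ S.cartan × ZMod 2} {x y : L} (hx : x ∈ S.piece p)
    (hy : y ∈ S.piece q) : S.br x y ∈ S.piece (p + q) := by
  refine mem_piece.2 ⟨S.br_mem hx.1 hy.1, fun h => ?_⟩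
  rw [S.jacobi y (S.cartan_even h.2) hx.1, hx.2 h, hy.2 h, zero_mul, sgn_zero, one_smul,
    map_smul, map_smul, LinearMap.smul_apply, Prod.fst_add, LinearMap.add_apply, add_smul]

theorem br_swap_mem {s t : ZMod 2} {x y : L} {W : Submodule ℂ L} (hx : x ∈ S.gr s)
    (hy : y ∈ S.gr t) (h : S.br x y ∈ W) : S.br y x ∈ W := by
  rw [S.skew hy hx]
  exact W.neg_mem (W.smul_mem _ h)

theorem br_e_f_mem (i j : ι) : S.br (S.e i) (S.f j) ∈ S.cartan := by
  by_cases hij : i = j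
  · subst hij
    have h := br_mem_piece (S.e_mem_piece i) (S.f_mem_piece i)
    rw [Prod.mk_add_mk, add_neg_cancel] at h
    have h2 := h.2
    rwa [S.rootSpace_zero] at h2
  · rw [S.e_f_ne i j hij]
    exact S.cartan.zero_mem

/-! ### Iterated brackets of generators -/

variable (S) in
/-- The iterated bracket `[x_{i₁}, [x_{i₂}, … [x_{iᵣ}, x_j]]]`. -/
def word (x : ι → L) (j : ι) : List ι → L
  | [] => x j
  | i :: w => S.br (x i) (word x j w)

variable (S) in
/-- The span of the iterated brackets. -/
def wordSpan (x : ι → L) : Submodule ℂ L := Submodule.span ℂ {z | ∃ j w, z = S.word x j w}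

theorem word_mem (x : ι → L) (j : ι) (w : List ι) : S.word x j w ∈ S.wordSpan x :=
  Submodule.subset_span ⟨j, w, rfl⟩

section Word

variable {x y : ι → L} {β : ι → Module.Dual ℂ S.cartan} {p : ι → ZMod 2}

theorem word_mem_piece (hx : ∀ i, x i ∈ S.piece (β i, p i)) (j : ι) (w : List ι) :
    S.word x j w ∈ S.piece (((j :: w).map β).sum, ((j :: w).map p).sum) := by
  induction w with
  | nil => simpa [word] using hx j
  | cons i w ih =>
    have h := br_mem_piece (hx i) ih
    rw [Prod.mk_add_mk] at h
    simp only [List.map_cons, List.sum_cons] at h ⊢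
    rwa [add_left_comm (β j), add_left_comm (p j)]

theorem cartan_br_wordSpan (hx : ∀ i, x i ∈ S.piece (β i, p i)) {h z : L} (hh : h ∈ S.cartan)
    (hz : z ∈ S.wordSpan x) : S.br h z ∈ S.wordSpan x := by
  have hle : S.wordSpan x ≤ (S.wordSpan x).comap (S.br h) := by
    refine Submodule.span_le.2 ?_
    rintro _ ⟨j, w, rfl⟩
    rw [SetLike.mem_coe, Submodule.mem_comap, (word_mem_piece hx j w).2 ⟨h, hh⟩]
    exact Submodule.smul_mem _ _ (word_mem x j w)
  exact hle hz

theorem br_wordSpan (hx : ∀ i, x i ∈ S.piece (β i, p i)) (i : ι) {z : L}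
    (hz : z ∈ S.cartan ⊔ S.wordSpan x) : S.br (x i) z ∈ S.wordSpan x := by
  have hle : S.cartan ⊔ S.wordSpan x ≤ (S.wordSpan x).comap (S.br (x i)) := by
    refine sup_le (fun h hh => ?_) (Submodule.span_le.2 ?_)
    · rw [Submodule.mem_comap]
      refine br_swap_mem (S.cartan_even hh) (hx i).1 ?_
      exact cartan_br_wordSpan hx hh (word_mem x i [])
    · rintro _ ⟨j, w, rfl⟩
      exact word_mem x j (i :: w)
  exact hle hz

/-- Induction on the word: `[y_k, [x_i, z]] = [[y_k, x_i], z] ± [x_i, [y_k, z]]`, where `[y_k, x_i]`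
lies in `H`. Stated for abstract `x`, `y` so that it serves both for `e` acting on words in `f` and
for `f` acting on words in `e`. -/
theorem br_opposite_wordSpan (hx : ∀ i, x i ∈ S.piece (β i, p i)) (hy : ∀ i, y i ∈ S.gr (p i))
    (hyx : ∀ i j, S.br (y i) (x j) ∈ S.cartan) (k : ι) {z : L} (hz : z ∈ S.wordSpan x) :
    S.br (y k) z ∈ S.cartan ⊔ S.wordSpan x := by
  have hle : S.wordSpan x ≤ (S.cartan ⊔ S.wordSpan x).comap (S.br (y k)) := by
    refine Submodule.span_le.2 ?_
    rintro _ ⟨j, w, rfl⟩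
    rw [SetLike.mem_coe, Submodule.mem_comap]
    induction w with
    | nil => exact Submodule.mem_sup_left (hyx k j)
    | cons i w ih =>
      rw [word, S.jacobi _ (hy k) (hx i).1]
      refine Submodule.mem_sup_right (Submodule.add_mem _ ?_ (Submodule.smul_mem _ _ ?_))
      · exact cartan_br_wordSpan hx (hyx k i) (word_mem x j w)
      · exact br_wordSpan hx i ih
  exact hle hz

end Word

/-! ### The triangular decomposition -/

/-- The elements `x` with `[x, W] ⊆ W` form a subalgebra by the Jacobi identity. Since that identity
is available only for homogeneous arguments, the argument is run with the sum of the homogeneous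
parts `N ⊓ S.gr s`, which contains the generators and so is everything. -/
theorem br_mem_of_generators {W : Submodule ℂ L} (hH : ∀ h ∈ S.cartan, ∀ z ∈ W, S.br h z ∈ W)
    (he : ∀ i, ∀ z ∈ W, S.br (S.e i) z ∈ W) (hf : ∀ i, ∀ z ∈ W, S.br (S.f i) z ∈ W) (x : L) :
    ∀ z ∈ W, S.br x z ∈ W := by
  let N : Submodule ℂ L := {
    carrier := {x | ∀ z ∈ W, S.br x z ∈ W}
    add_mem' := by
      intro a b ha hb z hz
      rw [map_add, LinearMap.add_apply]
      exact W.add_mem (ha z hz) (hb z hz)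
    zero_mem' := by
      intro z _
      rw [map_zero, LinearMap.zero_apply]
      exact W.zero_mem
    smul_mem' := by
      intro c a ha z hz
      rw [map_smul, LinearMap.smul_apply]
      exact W.smul_mem c (ha z hz) }
  have hbr : ∀ {s t : ZMod 2} {a b : L}, a ∈ N ⊓ S.gr s → b ∈ N ⊓ S.gr t →
      S.br a b ∈ N ⊓ S.gr (s + t) := by
    intro s t a b ha hb
    refine ⟨fun z hz => ?_, S.br_mem ha.2 hb.2⟩
    have h := S.jacobi z ha.2 hb.2
    rw [← sub_eq_iff_eq_add] at h
    rw [← h]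
    exact W.sub_mem (ha.1 _ (hb.1 z hz)) (W.smul_mem _ (hb.1 _ (ha.1 z hz)))
  have hle : ∀ s, N ⊓ S.gr s ≤ ⨆ s, N ⊓ S.gr s := fun s => le_iSup (fun s => N ⊓ S.gr s) s
  have htop : ⨆ s, N ⊓ S.gr s = ⊤ := by
    refine S.generated _ (fun h hh => ?_) (fun i => ?_) (fun i => ?_) ?_
    · exact hle 0 ⟨hH h hh, S.cartan_even hh⟩
    · exact hle _ ⟨he i, S.e_even i⟩
    · exact hle _ ⟨hf i, S.f_even i⟩
    · intro a ha b hb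
      induction ha using Submodule.iSup_induction' with
      | mem s a ha =>
        induction hb using Submodule.iSup_induction' with
        | mem t b hb => exact hle _ (hbr ha hb)
        | zero => rw [map_zero]; exact Submodule.zero_mem _
        | add b b' _ _ h h' => rw [map_add]; exact Submodule.add_mem _ h h'
      | zero => rw [map_zero, LinearMap.zero_apply]; exact Submodule.zero_mem _
      | add a a' _ _ h h' => rw [map_add, LinearMap.add_apply]; exact Submodule.add_mem _ h h'
  have hN : ⨆ s, N ⊓ S.gr s ≤ N := iSup_le fun s => inf_le_left
  rw [htop] at hN
  exact hN (Submodule.mem_top (x := x))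

/-- The sum is stable under the adjoint action of the generators, hence of all of `L`; it is
therefore a subalgebra containing the generators. -/
theorem triangular_decomposition : S.cartan ⊔ S.wordSpan S.e ⊔ S.wordSpan S.f = ⊤ := by
  have hfe : ∀ i j, S.br (S.f i) (S.e j) ∈ S.cartan := fun i j =>
    br_swap_mem (S.e_even j) (S.f_even i) (S.br_e_f_mem j i)
  have hHe : ∀ h ∈ S.cartan, ∀ h' ∈ S.cartan, S.br h h' ∈ S.cartan := fun h hh h' hh' => by
    rw [(S.mem_piece_zero hh').2 ⟨h, hh⟩, LinearMap.zero_apply, zero_smul]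
    exact S.cartan.zero_mem
  have hstable := S.br_mem_of_generators (W := S.cartan ⊔ S.wordSpan S.e ⊔ S.wordSpan S.f)
    (fun h hh => ?_) (fun i => ?_) (fun i => ?_)
  · refine S.generated _ (le_sup_left.trans le_sup_left) (fun i => ?_) (fun i => ?_)
      fun x _ y hy => hstable x y hy
    · exact Submodule.mem_sup_left (Submodule.mem_sup_right (word_mem S.e i []))
    · exact Submodule.mem_sup_right (word_mem S.f i [])
  · suffices hle : S.cartan ⊔ S.wordSpan S.e ⊔ S.wordSpan S.f ≤
        (S.cartan ⊔ S.wordSpan S.e ⊔ S.wordSpan S.f).comap (S.br h) from fun z hz => hle hz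
    refine sup_le (sup_le (fun z hz => ?_) fun z hz => ?_) fun z hz => ?_
    · exact Submodule.mem_sup_left (Submodule.mem_sup_left (hHe h hh z hz))
    · exact Submodule.mem_sup_left (Submodule.mem_sup_right
        (cartan_br_wordSpan S.e_mem_piece hh hz))
    · exact Submodule.mem_sup_right (cartan_br_wordSpan S.f_mem_piece hh hz)
  · suffices hle : S.cartan ⊔ S.wordSpan S.e ⊔ S.wordSpan S.f ≤
        (S.cartan ⊔ S.wordSpan S.e ⊔ S.wordSpan S.f).comap (S.br (S.e i)) from fun z hz => hle hz
    refine sup_le (fun z hz => ?_) fun z hz => ?_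
    · exact Submodule.mem_sup_left (Submodule.mem_sup_right (br_wordSpan S.e_mem_piece i hz))
    · have hle : S.cartan ⊔ S.wordSpan S.f ≤ S.cartan ⊔ S.wordSpan S.e ⊔ S.wordSpan S.f :=
        sup_le_sup_right le_sup_left _
      exact hle (br_opposite_wordSpan S.f_mem_piece S.e_even S.br_e_f_mem i hz)
  · suffices hle : S.cartan ⊔ S.wordSpan S.e ⊔ S.wordSpan S.f ≤
        (S.cartan ⊔ S.wordSpan S.e ⊔ S.wordSpan S.f).comap (S.br (S.f i)) from fun z hz => hle hz
    refine sup_le (sup_le (fun z hz => ?_) fun z hz => ?_) fun z hz => ?_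
    · exact Submodule.mem_sup_right
        (br_wordSpan S.f_mem_piece i (Submodule.mem_sup_left hz))
    · exact Submodule.mem_sup_left
        (br_opposite_wordSpan S.e_mem_piece S.f_even hfe i hz)
    · exact Submodule.mem_sup_right
        (br_wordSpan S.f_mem_piece i (Submodule.mem_sup_right hz))

variable (S) in
/-- The elements of `H` and the iterated brackets of simple generators. -/
def spanningSet : Set L :=
  S.cartan ∪ {z | ∃ j w, z = S.word S.e j w} ∪ {z | ∃ j w, z = S.word S.f j w}

theorem span_spanningSet : Submodule.span ℂ S.spanningSet = ⊤ := by
  rw [spanningSet, Submodule.span_union, Submodule.span_union, Submodule.span_eq]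
  exact triangular_decomposition

/-- The projection `T` onto the piece fixes `x`, while each spanning element, being homogeneous, is
either fixed or killed by it. -/
theorem mem_span_of_mem_piece {p : Module.Dual ℂ S.cartan × ZMod 2} {x : L}
    (hx : x ∈ S.piece p) : x ∈ Submodule.span ℂ (S.spanningSet ∩ S.piece p) := by
  classical
  have hG : ∀ z ∈ S.spanningSet, ∃ q, z ∈ S.piece q := by
    rintro z ((hz | ⟨j, w, rfl⟩) | ⟨j, w, rfl⟩)
    · exact ⟨_, S.mem_piece_zero hz⟩
    · exact ⟨_, word_mem_piece S.e_mem_piece j w⟩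
    · exact ⟨_, word_mem_piece S.f_mem_piece j w⟩
  let T := scalarOn S.isInternal_piece fun q => if q = p then 1 else 0
  have hTx : T x = x := by
    rw [scalarOn_apply S.isInternal_piece _ hx, if_pos rfl, one_smul]
  have hle : Submodule.span ℂ S.spanningSet ≤
      (Submodule.span ℂ (S.spanningSet ∩ S.piece p)).comap T := by
    refine Submodule.span_le.2 fun z hz => ?_
    obtain ⟨q, hq⟩ := hG z hz
    rw [SetLike.mem_coe, Submodule.mem_comap, scalarOn_apply S.isInternal_piece _ hq]
    by_cases hqp : q = p
    · subst hqp
      exact Submodule.smul_mem _ _ (Submodule.subset_span ⟨hz, hq⟩)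
    · rw [if_neg hqp, zero_smul]
      exact Submodule.zero_mem _
  rw [span_spanningSet] at hle
  have h := hle (Submodule.mem_top (x := x))
  rwa [Submodule.mem_comap, hTx] at h

/-! ### The positive cone -/

variable (S) in
/-- The sums of simple roots. -/
def posCone : AddSubmonoid (Module.Dual ℂ S.cartan) := AddSubmonoid.closure (Set.range S.root)

theorem root_mem_posCone (i : ι) : S.root i ∈ S.posCone :=
  AddSubmonoid.subset_closure ⟨i, rfl⟩

-- The coefficient functional on the span of the simple roots, extended to all of the dual because
-- the simple roots need not span it.
variable (S) in
theorem exists_coord (i : ι) : ∃ φ : Module.Dual ℂ S.cartan →ₗ[ℂ] ℂ,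
    φ (S.root i) = 1 ∧ ∀ j, j ≠ i → φ (S.root j) = 0 := by
  classical
  obtain ⟨φ, hφ⟩ := LinearMap.exists_extend
    ((Finsupp.lapply i : (ι →₀ ℂ) →ₗ[ℂ] ℂ) ∘ₗ S.root_indep.repr)
  have key : ∀ j, φ (S.root j) = Finsupp.single j (1 : ℂ) i := by
    intro j
    have hj : S.root j ∈ Submodule.span ℂ (Set.range S.root) := Submodule.subset_span ⟨j, rfl⟩
    have h := LinearMap.congr_fun hφ ⟨S.root j, hj⟩
    rw [LinearMap.comp_apply, LinearMap.comp_apply,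
      S.root_indep.repr_eq_single j ⟨S.root j, hj⟩ rfl] at h
    exact h
  refine ⟨φ, by rw [key, Finsupp.single_eq_same], fun j hj => ?_⟩
  rw [key, Finsupp.single_eq_of_ne (Ne.symm hj)]

variable (S) in
/-- The coefficient of a simple root. -/
def coord (i : ι) : Module.Dual ℂ S.cartan →ₗ[ℂ] ℂ := (S.exists_coord i).choose

theorem coord_same (i : ι) : S.coord i (S.root i) = 1 := (S.exists_coord i).choose_spec.1

theorem coord_ne {i j : ι} (h : j ≠ i) : S.coord i (S.root j) = 0 :=
  (S.exists_coord i).choose_spec.2 j h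

theorem coord_nat (i : ι) {β : Module.Dual ℂ S.cartan} (hβ : β ∈ S.posCone) :
    ∃ n : ℕ, S.coord i β = n := by
  induction hβ using AddSubmonoid.closure_induction with
  | mem β h =>
    obtain ⟨j, rfl⟩ := h
    by_cases hj : j = i
    · exact ⟨1, by rw [hj, coord_same, Nat.cast_one]⟩
    · exact ⟨0, by rw [coord_ne hj, Nat.cast_zero]⟩
  | zero => exact ⟨0, by simp⟩
  | add β γ _ _ h h' =>
    obtain ⟨n, hn⟩ := h
    obtain ⟨m, hm⟩ := h'
    exact ⟨n + m, by rw [map_add, hn, hm, Nat.cast_add]⟩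

/-- Coefficients on the cone are natural numbers, so there is no cancellation. All positivity
arguments below rest on this. -/
theorem coord_eq_zero_of_add {i : ι} {β γ : Module.Dual ℂ S.cartan} (hβ : β ∈ S.posCone)
    (hγ : γ ∈ S.posCone) (h : S.coord i (β + γ) = 0) : S.coord i β = 0 ∧ S.coord i γ = 0 := by
  obtain ⟨n, hn⟩ := S.coord_nat i hβ
  obtain ⟨m, hm⟩ := S.coord_nat i hγ
  rw [map_add, hn, hm, ← Nat.cast_add, Nat.cast_eq_zero] at h
  rw [hn, hm, Nat.cast_eq_zero, Nat.cast_eq_zero]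
  omega

theorem eq_nsmul_of_coord {i : ι} {β : Module.Dual ℂ S.cartan} (hβ : β ∈ S.posCone)
    (h : ∀ j, j ≠ i → S.coord j β = 0) : ∃ n : ℕ, β = n • S.root i := by
  induction hβ using AddSubmonoid.closure_induction with
  | mem β hβ =>
    obtain ⟨j, rfl⟩ := hβ
    by_cases hj : j = i
    · exact ⟨1, by rw [hj, one_smul]⟩
    · have h1 := h j hj
      rw [coord_same] at h1
      exact absurd h1 one_ne_zero
  | zero => exact ⟨0, by simp⟩
  | add β γ hβ hγ ih ih' =>
    obtain ⟨n, rfl⟩ := ih fun j hj => (coord_eq_zero_of_add hβ hγ (h j hj)).1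
    obtain ⟨m, rfl⟩ := ih' fun j hj => (coord_eq_zero_of_add hβ hγ (h j hj)).2
    exact ⟨n + m, (add_smul _ _ _).symm⟩

theorem sum_root_mem_posCone (w : List ι) : (w.map S.root).sum ∈ S.posCone := by
  refine AddSubmonoid.list_sum_mem _ fun β hβ => ?_
  obtain ⟨i, _, rfl⟩ := List.mem_map.1 hβ
  exact S.root_mem_posCone i

theorem eq_replicate_of_sum_root {i : ι} {k : ℕ} (w : List ι)
    (h : (w.map S.root).sum = k • S.root i) : w = List.replicate k i := by
  have hall : ∀ j ∈ w, j = i := by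
    intro j hj
    by_contra hne
    obtain ⟨u, v, rfl⟩ := List.append_of_mem hj
    have h1 := congrArg (S.coord j) h
    rw [map_nsmul, coord_ne (Ne.symm hne), smul_zero, List.map_append, List.map_cons,
      List.sum_append, List.sum_cons] at h1
    have h2 := coord_eq_zero_of_add (sum_root_mem_posCone u)
      (add_mem (root_mem_posCone j) (sum_root_mem_posCone v)) h1
    have h3 := coord_eq_zero_of_add (root_mem_posCone j) (sum_root_mem_posCone v) h2.2
    rw [coord_same] at h3
    exact one_ne_zero h3.1
  have hw : w = List.replicate w.length i := List.eq_replicate_iff.2 ⟨rfl, hall⟩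
  rw [hw, List.map_replicate, List.sum_replicate] at h
  have h1 := congrArg (S.coord i) h
  rw [map_nsmul, map_nsmul, coord_same, nsmul_eq_mul, nsmul_eq_mul, mul_one, mul_one] at h1
  rw [← Nat.cast_injective h1]
  exact hw

theorem sum_neg_root (w : List ι) :
    (w.map fun i => -S.root i).sum = -(w.map S.root).sum := by
  induction w with
  | nil => simp
  | cons i w ih => rw [List.map_cons, List.map_cons, List.sum_cons, List.sum_cons, ih, neg_add]

/-- A nonzero piece contains a nonzero spanning element: an element of `H`, a word in `e` or a word
in `f`, and each has a weight of the required sign. -/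
theorem posCone_or_neg {p : Module.Dual ℂ S.cartan × ZMod 2} {x : L} (hx : x ∈ S.piece p)
    (hx0 : x ≠ 0) : p.1 ∈ S.posCone ∨ -p.1 ∈ S.posCone := by
  by_contra hcon
  push Not at hcon
  have hbot : Submodule.span ℂ (S.spanningSet ∩ S.piece p) ≤ ⊥ := by
    refine Submodule.span_le.2 ?_
    rintro z ⟨hz, hzp⟩
    by_contra hz0
    rw [SetLike.mem_coe, Submodule.mem_bot] at hz0
    rcases hz with (hz | ⟨j, w, rfl⟩) | ⟨j, w, rfl⟩
    · have h := eq_of_mem_piece hz0 hzp (S.mem_piece_zero hz)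
      exact hcon.1 (by rw [h]; exact S.posCone.zero_mem)
    · have h := eq_of_mem_piece hz0 hzp (word_mem_piece S.e_mem_piece j w)
      exact hcon.1 (by rw [h]; exact sum_root_mem_posCone _)
    · have h := eq_of_mem_piece hz0 hzp (word_mem_piece S.f_mem_piece j w)
      exact hcon.2 (by rw [h, sum_neg_root, neg_neg]; exact sum_root_mem_posCone _)
  exact hx0 ((Submodule.mem_bot ℂ).1 (hbot (mem_span_of_mem_piece hx)))

theorem nsmul_root_ne_zero {i : ι} {k : ℕ} (hk : k ≠ 0) : k • S.root i ≠ 0 := by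
  intro h
  have h1 := congrArg (S.coord i) h
  rw [map_nsmul, coord_same, nsmul_eq_mul, mul_one, map_zero, Nat.cast_eq_zero] at h1
  exact hk h1

/-- The weight spaces of the multiples of a simple root. -/
theorem piece_nsmul_root_le (i : ι) (k : ℕ) (s : ZMod 2) :
    S.piece ((k + 1) • S.root i, s) ≤
      Submodule.span ℂ {S.word S.e i (List.replicate k i)} := by
  intro x hx
  refine Submodule.span_le.2 ?_ (mem_span_of_mem_piece hx)
  rintro z ⟨hz, hzp⟩
  by_cases hz0 : z = 0
  · rw [hz0]
    exact Submodule.zero_mem _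
  rcases hz with (hz | ⟨j, w, rfl⟩) | ⟨j, w, rfl⟩
  · have h := eq_of_mem_piece hz0 hzp (S.mem_piece_zero hz)
    exact absurd (congrArg Prod.fst h) (nsmul_root_ne_zero k.succ_ne_zero)
  · have h := congrArg Prod.fst (eq_of_mem_piece hz0 hzp (word_mem_piece S.e_mem_piece j w))
    -- A word consists of its innermost letter `j` and the list `w`, so `k + 1` letters leave a list
    -- of length `k`.
    have h1 := eq_replicate_of_sum_root _ h.symm
    rw [List.replicate_succ, List.cons.injEq] at h1
    rw [h1.1, h1.2]
    exact Submodule.subset_span rfl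
  · have h := congrArg Prod.fst (eq_of_mem_piece hz0 hzp (word_mem_piece S.f_mem_piece j w))
    rw [sum_neg_root] at h
    -- A word in `f` has weight in the negative cone; were it `(k + 1) α_i`, two elements of the
    -- cone would add up to zero.
    have h0 : S.coord i ((k + 1) • S.root i + ((j :: w).map S.root).sum) = 0 := by
      rw [show (k + 1) • S.root i = -((j :: w).map S.root).sum from h, neg_add_cancel, map_zero]
    have h1 := (coord_eq_zero_of_add (S.posCone.nsmul_mem (root_mem_posCone i) _)
      (sum_root_mem_posCone _) h0).1
    rw [map_nsmul, coord_same, nsmul_eq_mul, mul_one, Nat.cast_eq_zero] at h1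
    exact absurd h1 k.succ_ne_zero

end BasicLieSuperalgebra

theorem zmod_two_mul_self (s : ZMod 2) : s * s = s := by
  revert s; decide

theorem zmod_two_add_self (s : ZMod 2) : s + s = 0 := by
  revert s; decide

namespace BasicLieSuperalgebra

variable {ι L : Type*} [AddCommGroup L] [Module ℂ L] {S : BasicLieSuperalgebra ι L}

/-! ### The weight spaces of the multiples of a simple root -/

variable (S) in
/-- `[e_i, f_i]` as an element of the Cartan subalgebra. -/
def corootElt (i : ι) : S.cartan := ⟨S.br (S.e i) (S.f i), S.br_e_f_mem i i⟩

theorem e_ne_zero (i : ι) : S.e i ≠ 0 := by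
  intro h
  refine S.root_indep.ne_zero i (LinearMap.ext fun x => ?_)
  rw [← S.e_f_same i x, h]
  simp

theorem br_e_e_eq_zero {i : ι} (h : S.parity i = 0) : S.br (S.e i) (S.e i) = 0 := by
  have h1 := S.skew (S.e_even i) (S.e_even i)
  rw [h, mul_zero, sgn_zero, one_smul] at h1
  have h2 : (2 : ℂ) • S.br (S.e i) (S.e i) = 0 := by
    linear_combination (norm := module) h1
  exact (smul_eq_zero.1 h2).resolve_left two_ne_zero

/-- For odd `e_i`, Jacobi together with skew symmetry gives `3 [e_i, [e_i, e_i]] = 0`. Hence no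
multiple of `α_i` beyond `2 α_i` is a root. -/
theorem br_e_br_e_e (i : ι) : S.br (S.e i) (S.br (S.e i) (S.e i)) = 0 := by
  have h1 := S.jacobi (S.e i) (S.e_even i) (S.e_even i)
  have h2 := S.skew (S.br_mem (S.e_even i) (S.e_even i)) (S.e_even i)
  rcases zmod_two_cases (S.parity i) with h | h
  · rw [br_e_e_eq_zero h, map_zero]
  · rw [zmod_two_add_self, zero_mul, sgn_zero, one_smul] at h2
    rw [h2, h, mul_one, sgn_one] at h1
    have h4 : (3 : ℂ) • S.br (S.e i) (S.br (S.e i) (S.e i)) = 0 := by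
      linear_combination (norm := module) h1
    exact (smul_eq_zero.1 h4).resolve_left three_ne_zero

theorem word_replicate_eq_zero (i : ι) (k : ℕ) :
    S.word S.e i (List.replicate (k + 2) i) = 0 := by
  induction k with
  | zero => exact S.br_e_br_e_e i
  | succ k ih =>
    rw [List.replicate_succ, word, ih, map_zero]

/-- For odd `e_i`, Jacobi gives `[f_i, [e_i, e_i]] = 2 α_i(h_i) e_i`. -/
theorem br_e_e_ne_zero {i : ι} (h : S.parity i = 1) (hi : S.root i (S.corootElt i) ≠ 0) :
    S.br (S.e i) (S.e i) ≠ 0 := by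
  intro h0
  have hef : S.br (S.e i) (S.f i) = S.corootElt i := rfl
  have hfe : S.br (S.f i) (S.e i) = S.corootElt i := by
    rw [S.skew (S.f_even i) (S.e_even i), h, mul_one, sgn_one, hef]
    module
  have h1 := S.jacobi (S.e i) (S.f_even i) (S.e_even i)
  have h2 : S.br (S.e i) (S.corootElt i) = -(S.root i (S.corootElt i) • S.e i) := by
    rw [S.skew (S.e_even i) (S.cartan_even (S.corootElt i).2), mul_zero, sgn_zero, one_smul,
      S.e_root i]
  rw [h0, map_zero, hfe, S.e_root i, h, mul_one, sgn_one, h2] at h1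
  have h3 : (2 * S.root i (S.corootElt i)) • S.e i = 0 := by
    linear_combination (norm := module) -h1
  rcases smul_eq_zero.1 h3 with h4 | h4
  · exact mul_ne_zero two_ne_zero hi h4
  · exact S.e_ne_zero i h4

theorem br_e_e_mem (i : ι) : S.br (S.e i) (S.e i) ∈ S.piece (2 • S.root i, 0) := by
  have h := br_mem_piece (S.e_mem_piece i) (S.e_mem_piece i)
  rwa [Prod.mk_add_mk, ← two_nsmul, zmod_two_add_self] at h

theorem finrank_piece_root (i : ι) :
    Module.finrank ℂ (S.piece (1 • S.root i, S.parity i)) = 1 := by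
  have h : S.piece (1 • S.root i, S.parity i) = Submodule.span ℂ {S.e i} := by
    refine le_antisymm (S.piece_nsmul_root_le i 0 _) ?_
    rw [Submodule.span_singleton_le_iff_mem, one_smul]
    exact S.e_mem_piece i
  rw [h]
  exact finrank_span_singleton (S.e_ne_zero i)

theorem piece_two_nsmul_root (i : ι) :
    S.piece (2 • S.root i, 0) = Submodule.span ℂ {S.br (S.e i) (S.e i)} := by
  refine le_antisymm (S.piece_nsmul_root_le i 1 _) ?_
  rw [Submodule.span_singleton_le_iff_mem]
  exact S.br_e_e_mem i

theorem eq_of_piece_nsmul_root_ne_bot {i : ι} {k : ℕ} {s : ZMod 2}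
    (h : S.piece ((k + 1) • S.root i, s) ≠ ⊥) :
    ((k + 1) • S.root i, s) = (1 • S.root i, S.parity i) ∨
      ((k + 1) • S.root i, s) = (2 • S.root i, (0 : ZMod 2)) := by
  obtain ⟨x, hx, hx0⟩ := Submodule.exists_mem_ne_zero_of_ne_bot h
  obtain ⟨c, rfl⟩ := Submodule.mem_span_singleton.1 (S.piece_nsmul_root_le i k s hx)
  match k with
  | 0 =>
    refine Or.inl (eq_of_mem_piece hx0 hx (Submodule.smul_mem _ _ ?_))
    rw [one_smul]
    exact S.e_mem_piece i
  | 1 => exact Or.inr (eq_of_mem_piece hx0 hx (Submodule.smul_mem _ _ (S.br_e_e_mem i)))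
  | k + 2 => exact absurd (by rw [word_replicate_eq_zero, smul_zero]) hx0

-- Only `(α_i, [i])` and `(2 α_i, 0)` can contribute. In the odd case with `α_i(h_i) ≠ 0` both have
-- multiplicity one and the total is `(-1 + 2) α_i(h_i)`; this is where the even root `2 α_i`
-- compensates the sign of the odd root `α_i`.
open Classical in
theorem finsum_nsmul_root (i : ι) :
    ∑ᶠ p : Module.Dual ℂ S.cartan × ZMod 2,
      (sgn p.2 * (if ∃ k : ℕ, p.1 = (k + 1) • S.root i then 1 else 0) * p.1 (S.corootElt i)) *
        Module.finrank ℂ (S.piece p) = S.root i (S.corootElt i) := by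
  have hne : ((1 • S.root i, S.parity i) : Module.Dual ℂ S.cartan × ZMod 2) ≠
      (2 • S.root i, 0) := by
    intro h
    have h1 := congrArg (fun p => S.coord i p.1) h
    simp only [map_nsmul, coord_same, nsmul_eq_mul, mul_one] at h1
    norm_num at h1
  rw [finsum_eq_sum_of_support_subset
    (s := {(1 • S.root i, S.parity i), (2 • S.root i, (0 : ZMod 2))}), Finset.sum_pair hne]
  · rw [if_pos ⟨0, by rw [zero_add]⟩, if_pos ⟨1, rfl⟩, finrank_piece_root, sgn_zero,
      LinearMap.smul_apply, LinearMap.smul_apply, one_smul, two_smul, Nat.cast_one]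
    rcases zmod_two_cases (S.parity i) with h | h
    · have h0 : Module.finrank ℂ (S.piece (2 • S.root i, 0)) = 0 := by
        rw [piece_two_nsmul_root, br_e_e_eq_zero h, Submodule.span_zero_singleton]
        exact finrank_bot ℂ L
      rw [h0, h, sgn_zero, Nat.cast_zero]
      ring
    · by_cases hi : S.root i (S.corootElt i) = 0
      · rw [hi]
        ring
      · have h1 : Module.finrank ℂ (S.piece (2 • S.root i, 0)) = 1 := by
          rw [piece_two_nsmul_root]
          exact finrank_span_singleton (br_e_e_ne_zero h hi)
        rw [h1, h, sgn_one, Nat.cast_one]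
        ring
  · rintro ⟨β, s⟩ hp
    have h1 : ∃ k : ℕ, β = (k + 1) • S.root i := by
      by_contra hcon
      exact hp (by simp only [if_neg hcon, mul_zero, zero_mul])
    obtain ⟨k, rfl⟩ := h1
    have h2 : S.piece ((k + 1) • S.root i, s) ≠ ⊥ := by
      intro hbot
      refine hp ?_
      have h : Module.finrank ℂ (S.piece ((k + 1) • S.root i, s)) = 0 := by
        rw [hbot]; exact finrank_bot ℂ L
      simp only [h, Nat.cast_zero, mul_zero]
    have h3 := eq_of_piece_nsmul_root_ne_bot h2
    rw [Finset.mem_coe, Finset.mem_insert, Finset.mem_singleton]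
    exact h3

/-! ### Supertraces -/

variable (S) in
/-- The weights in the positive cone that are not multiples of the simple root `α_i`. -/
def transverse (i : ι) : Set (Module.Dual ℂ S.cartan) :=
  {β | β ∈ S.posCone ∧ ∀ k : ℕ, β ≠ k • S.root i}

/-- A transverse weight has a positive coefficient at some simple root other than `α_i`. Shifting by
`α_i` does not change it, and a weight that is positive or negative as a whole is then forced to be
positive. -/
theorem transverse_add_root {i : ι} {β : Module.Dual ℂ S.cartan}
    (hβ : β ∈ S.posCone ∨ -β ∈ S.posCone) :
    S.root i + β ∈ S.transverse i ↔ β ∈ S.transverse i := by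
  have hpos : ∀ γ ∈ S.posCone, ∀ δ ∈ S.posCone, ∀ k : ℕ, γ + δ = k • S.root i →
      ∃ n : ℕ, γ = n • S.root i := by
    intro γ hγ δ hδ k h
    refine eq_nsmul_of_coord hγ fun j hj => (coord_eq_zero_of_add hγ hδ ?_).1
    rw [h, map_nsmul, coord_ne hj.symm, smul_zero]
  constructor
  · rintro ⟨h1, h2⟩
    rcases hβ with hβ | hβ
    · exact ⟨hβ, fun k hk => h2 (k + 1) (by rw [hk, add_smul, one_smul, add_comm])⟩
    · obtain ⟨n, hn⟩ := hpos _ h1 _ hβ 1 (by rw [add_neg_cancel_right, one_smul])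
      exact absurd hn (h2 n)
  · rintro ⟨h1, h2⟩
    refine ⟨add_mem (root_mem_posCone i) h1, fun k hk => ?_⟩
    obtain ⟨n, hn⟩ := hpos _ h1 _ (root_mem_posCone i) k (by rw [add_comm, hk])
    exact h2 n hn

variable [FiniteDimensional ℂ L]

theorem finite_support_mul_finrank (g : Module.Dual ℂ S.cartan × ZMod 2 → ℂ) :
    (Function.support fun p => g p * Module.finrank ℂ (S.piece p)).Finite := by
  classical
  refine (WellFoundedGT.finite_ne_bot_of_iSupIndep
    S.isInternal_piece.submodule_iSupIndep).subset fun p hp hbot => hp ?_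
  have h : Module.finrank ℂ (S.piece p) = 0 := by rw [hbot]; exact finrank_bot ℂ L
  simp [h]

-- The sum is the supertrace of `ad [e_i, f_i]` over the transverse weight spaces. With `T` the
-- signed projection onto them, it equals `tr (T e f) - (-1)^[i] tr (T f e)`, which vanishes by
-- cyclicity of the trace.
open Classical in
theorem finsum_transverse (i : ι) :
    ∑ᶠ p : Module.Dual ℂ S.cartan × ZMod 2,
      (sgn p.2 * (if p.1 ∈ S.transverse i then 1 else 0) * p.1 (S.corootElt i)) *
        Module.finrank ℂ (S.piece p) = 0 := by
  set g : Module.Dual ℂ S.cartan × ZMod 2 → ℂ :=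
    fun p => sgn p.2 * (if p.1 ∈ S.transverse i then 1 else 0)
  rw [← trace_scalarOn S.isInternal_piece]
  set T := scalarOn S.isInternal_piece g
  -- `ad e_i` preserves transversality and shifts parity by `[i]`, so it commutes with the signed
  -- projection up to `(-1)^[i]`.
  have hTE : T ∘ₗ S.br (S.e i) = sgn (S.parity i) • (S.br (S.e i) ∘ₗ T) := by
    refine linearMap_ext_of_isInternal S.isInternal_piece fun p x hx => ?_
    have hbr := br_mem_piece (S.e_mem_piece i) hx
    rw [LinearMap.smul_apply, LinearMap.comp_apply, LinearMap.comp_apply,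
      scalarOn_apply S.isInternal_piece g hx, scalarOn_apply S.isInternal_piece g hbr, map_smul,
      smul_smul]
    by_cases hx0 : x = 0
    · rw [hx0, map_zero, smul_zero, smul_zero]
    congr 1
    simp only [g, Prod.fst_add, Prod.snd_add, transverse_add_root (posCone_or_neg hx hx0), sgn_add]
    ring
  have hT : scalarOn S.isInternal_piece (fun p => g p * p.1 (S.corootElt i)) =
      T ∘ₗ S.br (S.e i) ∘ₗ S.br (S.f i) -
        sgn (S.parity i) • (T ∘ₗ S.br (S.f i) ∘ₗ S.br (S.e i)) := by
    refine linearMap_ext_of_isInternal S.isInternal_piece fun p x hx => ?_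
    have h1 := S.jacobi x (S.e_even i) (S.f_even i)
    have h2 : S.br (S.br (S.e i) (S.f i)) x = p.1 (S.corootElt i) • x := hx.2 (S.corootElt i)
    rw [zmod_two_mul_self, h2, ← sub_eq_iff_eq_add] at h1
    simp only [LinearMap.sub_apply, LinearMap.smul_apply, LinearMap.comp_apply]
    rw [scalarOn_apply S.isInternal_piece _ hx, ← map_smul T, ← map_sub, h1, map_smul,
      scalarOn_apply S.isInternal_piece _ hx, smul_smul, mul_comm]
  have htr : LinearMap.trace ℂ L (T ∘ₗ S.br (S.f i) ∘ₗ S.br (S.e i)) =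
      sgn (S.parity i) * LinearMap.trace ℂ L (T ∘ₗ S.br (S.e i) ∘ₗ S.br (S.f i)) := by
    rw [← LinearMap.comp_assoc, LinearMap.trace_comp_comm', ← LinearMap.comp_assoc,
      ← LinearMap.comp_assoc, hTE, LinearMap.smul_comp, map_smul, smul_eq_mul, ← mul_assoc,
      sgn_mul_self, one_mul]
  rw [hT, map_sub, map_smul, htr, smul_eq_mul, ← mul_assoc, sgn_mul_self, one_mul, sub_self]

-- Allowing all weights, with an indicator of positivity, changes nothing since non-roots have
-- multiplicity zero; the sum then has the same shape as the trace formulas.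
open Classical in
theorem two_mul_halfSum (s : ZMod 2) (h : S.cartan) :
    2 * S.halfSum s h = ∑ᶠ β : Module.Dual ℂ S.cartan,
      ((if β ≠ 0 ∧ β ∈ S.posCone then 1 else 0) * β h) * Module.finrank ℂ (S.piece (β, s)) := by
  have hfin : (S.posRoots s).Finite := by
    have h1 := WellFoundedGT.finite_ne_bot_of_iSupIndep S.isInternal_piece.submodule_iSupIndep
    refine (h1.preimage (f := fun β => (β, s)) fun a _ b _ hab => (Prod.mk.inj hab).1).subset ?_
    exact fun β hβ => hβ.2.2
  have h2 := (LinearMap.applyₗ h : Module.Dual ℂ S.cartan →ₗ[ℂ] ℂ).toAddMonoidHom.map_finsum_mem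
    (fun β => (Module.finrank ℂ (S.piece (β, s)) : ℂ) • β) hfin
  have h3 : S.halfSum s h = (1 / 2 : ℂ) *
      ∑ᶠ β ∈ S.posRoots s, (Module.finrank ℂ (S.piece (β, s)) : ℂ) * β h := by
    rw [halfSum, LinearMap.smul_apply, smul_eq_mul]
    congr 1
  rw [h3, ← mul_assoc, mul_one_div_cancel two_ne_zero, one_mul]
  refine finsum_congr fun β => ?_
  by_cases hβ : β ∈ S.posRoots s
  · rw [finsum_eq_if, if_pos hβ, if_pos ⟨hβ.1, hβ.2.1⟩]
    ring
  · rw [finsum_eq_if, if_neg hβ]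
    by_cases hc : β ≠ 0 ∧ β ∈ S.posCone
    · have hbot : S.piece (β, s) = ⊥ := by
        by_contra hcon
        exact hβ ⟨hc.1, hc.2, hcon⟩
      have h : Module.finrank ℂ (S.piece (β, s)) = 0 := by rw [hbot]; exact finrank_bot ℂ L
      rw [h, Nat.cast_zero, mul_zero]
    · rw [if_neg hc, zero_mul, zero_mul]

open Classical in
theorem two_mul_rho (h : S.cartan) :
    2 * S.rho h = ∑ᶠ p : Module.Dual ℂ S.cartan × ZMod 2,
      (sgn p.2 * (if p.1 ≠ 0 ∧ p.1 ∈ S.posCone then 1 else 0) * p.1 h) *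
        Module.finrank ℂ (S.piece p) := by
  have hfin : ∀ s, (Function.support fun β : Module.Dual ℂ S.cartan =>
      ((if β ≠ 0 ∧ β ∈ S.posCone then 1 else 0) * β h) *
        (Module.finrank ℂ (S.piece (β, s)) : ℂ)).Finite := fun s =>
    (finite_support_mul_finrank (S := S) fun p =>
      (if p.1 ≠ 0 ∧ p.1 ∈ S.posCone then 1 else 0) * p.1 h).preimage
        (f := fun β => (β, s)) fun a _ b _ hab => (Prod.mk.inj hab).1
  rw [finsum_curry _ (finite_support_mul_finrank (S := S) _), rho, LinearMap.sub_apply, mul_sub,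
    two_mul_halfSum, two_mul_halfSum, ← finsum_sub_distrib (hfin 0) (hfin 1)]
  refine finsum_congr fun β => ?_
  rw [finsum_eq_sum_of_fintype, show (Finset.univ : Finset (ZMod 2)) = {0, 1} by decide,
    Finset.sum_pair (by decide)]
  simp only [sgn_zero, sgn_one]
  ring

/-- The nonzero elements of the cone are the disjoint union of the positive multiples of `α_i` and
the transverse weights; the former give the right side, the latter zero. -/
theorem two_mul_rho_corootElt (i : ι) :
    2 * S.rho (S.corootElt i) = S.root i (S.corootElt i) := by
  classical
  rw [two_mul_rho, ← finsum_nsmul_root i, ← sub_eq_zero, ← finsum_sub_distrib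
    (finite_support_mul_finrank (S := S) _) (finite_support_mul_finrank (S := S) _)]
  refine (finsum_congr fun p => ?_).trans (finsum_transverse (S := S) i)
  rw [← sub_mul, ← sub_mul, ← mul_sub]
  congr 3
  by_cases hmult : ∃ k : ℕ, p.1 = k • S.root i
  · obtain ⟨k, hk⟩ := hmult
    rw [if_neg fun h : p.1 ∈ S.transverse i => h.2 k hk]
    match k with
    | 0 =>
      rw [zero_smul] at hk
      rw [if_neg fun h => h.1 hk, if_neg, sub_zero]
      rintro ⟨l, hl⟩
      exact nsmul_root_ne_zero l.succ_ne_zero (hl.symm.trans hk)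
    | k + 1 =>
      have hpos : p.1 ≠ 0 ∧ p.1 ∈ S.posCone := by
        rw [hk]
        exact ⟨nsmul_root_ne_zero k.succ_ne_zero, S.posCone.nsmul_mem (root_mem_posCone i) _⟩
      rw [if_pos hpos, if_pos ⟨k, hk⟩, sub_self]
  · push Not at hmult
    rw [if_neg (c := ∃ k : ℕ, p.1 = (k + 1) • S.root i) fun ⟨k, hk⟩ => hmult _ hk, sub_zero]
    refine if_congr ⟨fun h => ⟨h.2, hmult⟩, fun h => ⟨fun h0 => ?_, h.1⟩⟩ rfl rfl
    exact hmult 0 (by rw [h0, zero_smul])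

theorem simpleH_eq_corootElt (i : ι) : S.datum.simpleH i = S.corootElt i := by
  rw [← sub_eq_zero]
  refine S.cartan_separating _ fun y => ?_
  have h1 : S.form (S.datum.simpleH i : L) y = S.root i y := S.datum.form_dualVec (S.root i) y
  have h2 : S.form (S.corootElt i : L) y = S.root i y := S.e_f_same i y
  rw [Submodule.coe_sub, map_sub, LinearMap.sub_apply, h1, h2, sub_self]

/-- `2 (ρ, α_i) = (α_i, α_i)`. -/
theorem root_two_rho (i : ι) :
    S.root i ((2 : ℂ) • S.datum.dualVec S.rho) = S.root i (S.datum.simpleH i) := by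
  have h : S.root i (S.datum.dualVec S.rho) = S.rho (S.datum.simpleH i) := by
    have h1 := S.datum.form_dualVec (S.root i) (S.datum.dualVec S.rho)
    rw [S.datum.form_symm, S.datum.form_dualVec] at h1
    exact h1.symm
  rw [map_smul, smul_eq_mul, h, simpleH_eq_corootElt, two_mul_rho_corootElt]

end BasicLieSuperalgebra

section Quantum

variable {ι 𝔥 : Type*} [AddCommGroup 𝔥] [Module ℂ 𝔥] [FiniteDimensional ℂ 𝔥]
  {η : ℂ} {D : CartanDatum ι 𝔥}

/-! ### Coproducts of the generators, and centrality tested on generators -/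

namespace Uq

theorem k_e (h : 𝔥) (i : ι) : k η D h * e η D i = qpow η (D.root i h) • (e η D i * k η D h) := by
  rw [k, e, ← map_mul, PreU.k_e, map_smul, map_mul]

theorem k_f (h : 𝔥) (i : ι) : k η D h * f η D i = qpow η (-D.root i h) • (f η D i * k η D h) := by
  rw [k, f, ← map_mul, PreU.k_f, map_smul, map_mul]

theorem e_mem (i : ι) : e η D i ∈ gr η D (D.parity i) := proj_mem η D (PreU.e_mem η D i)

theorem f_mem (i : ι) : f η D i ∈ gr η D (D.parity i) := proj_mem η D (PreU.f_mem η D i)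

theorem k_mem (h : 𝔥) : k η D h ∈ gr η D 0 := proj_mem η D (PreU.k_mem η D h)

theorem comul_proj (x : PreU η D) :
    comul η D (proj η D x) = projTensor η D (PreU.comul η D x) := lift_proj ..

theorem comul_e (i : ι) : comul η D (e η D i) =
    k η D ((1 / 2 : ℂ) • D.simpleH i) ᵍ⊗ₜ[ℂ] e η D i +
      e η D i ᵍ⊗ₜ[ℂ] k η D (-((1 / 2 : ℂ) • D.simpleH i)) := by
  rw [e, comul_proj, PreU.comul, PreU.lift_e, map_add, projTensor_tmul, projTensor_tmul,
    ← neg_smul, ← neg_div]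
  rfl

theorem comul_f (i : ι) : comul η D (f η D i) =
    k η D ((1 / 2 : ℂ) • D.simpleH i) ᵍ⊗ₜ[ℂ] f η D i +
      f η D i ᵍ⊗ₜ[ℂ] k η D (-((1 / 2 : ℂ) • D.simpleH i)) := by
  rw [f, comul_proj, PreU.comul, PreU.lift_f, map_add, projTensor_tmul, projTensor_tmul,
    ← neg_smul, ← neg_div]
  rfl

theorem comul_k (h : 𝔥) : comul η D (k η D h) = k η D h ᵍ⊗ₜ[ℂ] k η D h := by
  rw [k, comul_proj, PreU.comul, PreU.lift_k, projTensor_tmul]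

/-- An element that commutes with the generators is central. -/
theorem commute_of_generators {c : Uq η D} (he : ∀ i, Commute (e η D i) c)
    (hf : ∀ i, Commute (f η D i) c) (hk : ∀ h, Commute (k η D h) c) (a : Uq η D) :
    Commute a c := by
  obtain ⟨x, rfl⟩ := proj_surjective η D a
  obtain ⟨y, rfl⟩ : ∃ y, PreU.mk η D y = x := RingQuot.mkAlgHom_surjective ℂ _ x
  induction y using FreeAlgebra.induction with
  | grade0 r =>
    rw [AlgHom.commutes, AlgHom.commutes]
    exact Algebra.commutes r c
  | grade1 g =>
    cases g with
    | e i => exact he i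
    | f i => exact hf i
    | k h => exact hk h
  | mul a b ha hb => rw [map_mul, map_mul]; exact ha.mul_left hb
  | add a b ha hb => rw [map_add, map_add]; exact ha.add_left hb

end Uq

/-! ### Quantum supertraces of matrices commuting with the coproduct -/

namespace Rep

theorem signed_apply {s t : ZMod 2} {y : Uq η D} (hy : y ∈ Uq.gr η D t) :
    signed s y = sgn (s * t) • y := by
  rcases zmod_two_cases s with rfl | rfl
  · rw [signed, if_pos rfl, zero_mul, sgn_zero, one_smul]
    rfl
  · rw [signed, if_neg (by decide), one_mul]
    exact hy

variable {n : ℕ} (π : Rep η D n) (R : UniversalRMatrix η D)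

/-- The sign comes from moving `b` past the basis vector `e_β`. -/
theorem act_tmul (a : Uq η D) {t : ZMod 2} {b : Uq η D} (hb : b ∈ Uq.gr η D t) (α β : Fin n) :
    π.act (a ᵍ⊗ₜ[ℂ] b) α β = (π.mat a α β * sgn (π.parity β * t)) • b := by
  have h : π.act (a ᵍ⊗ₜ[ℂ] b) α β = π.mat a α β • signed (π.parity β) b := rfl
  rw [h, signed_apply hb, smul_smul]

theorem act_add (x y : Uq.gr η D ᵍ⊗[ℂ] Uq.gr η D) : π.act (x + y) = π.act x + π.act y := by
  rw [act, map_add, map_add]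
  rfl

/-- `Rᵀ R Δ(a) = Rᵀ Δᵀ(a) R = Δ(a) Rᵀ R`. -/
theorem commute_charMatrix (a : Uq η D) :
    Commute (π.charMatrix R) (π.act (Uq.comul η D a)) := by
  have h : Commute (π.imRT R.θ * π.imR R.θ) (π.act (Uq.comul η D a)) := by
    change π.imRT R.θ * π.imR R.θ * π.act (Uq.comul η D a) =
      π.act (Uq.comul η D a) * (π.imRT R.θ * π.imR R.θ)
    rw [mul_assoc, R.intertwine, ← mul_assoc, R.intertwine_op, mul_assoc]
  exact ((Commute.one_left _).sub_left h).smul_left _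

/-- `str (q^{2 h_ρ} B)`. -/
def quantumStr (ρ : Module.Dual ℂ 𝔥) (B : Matrix (Fin n) (Fin n) (Uq η D)) : Uq η D :=
  ∑ α, (sgn (π.parity α) * qpow η (π.weight α ((2 : ℂ) • D.dualVec ρ))) • B α α

theorem invariant_eq_quantumStr (ρ : Module.Dual ℂ 𝔥) (m : ℕ) :
    π.invariant R ρ m = π.quantumStr ρ (π.charMatrix R ^ m) := by
  rw [invariant, str, quantumStr, π.mat_k, Matrix.diagonal_map (map_zero _)]
  refine Finset.sum_congr rfl fun α _ => ?_
  rw [Matrix.diagonal_mul, ← Algebra.smul_def, smul_smul]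

section QuantumStr

variable {π} {ρ : Module.Dual ℂ 𝔥} {B : Matrix (Fin n) (Fin n) (Uq η D)}

theorem act_comul_k (h : 𝔥) : π.act (Uq.comul η D (Uq.k η D h)) =
    Matrix.diagonal fun α => qpow η (π.weight α h) • Uq.k η D h := by
  ext α β
  rw [Uq.comul_k, act_tmul π _ (Uq.k_mem h), π.mat_k, mul_zero, sgn_zero, mul_one]
  by_cases hαβ : α = β
  · subst hαβ
    rw [Matrix.diagonal_apply_eq, Matrix.diagonal_apply_eq]
  · rw [Matrix.diagonal_apply_ne _ hαβ, Matrix.diagonal_apply_ne _ hαβ, zero_smul]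

theorem qpow_ne_zero (x : ℂ) : qpow η x ≠ 0 := Complex.exp_ne_zero _

/-- Commutation with `Δ(q^h)` read entrywise: `B α β` has weight `λ_β - λ_α` under conjugation by
`q^h`. -/
theorem k_mul_entry (hB : ∀ a, Commute B (π.act (Uq.comul η D a))) (h : 𝔥) (α β : Fin n) :
    qpow η (π.weight α h) • (Uq.k η D h * B α β) =
      qpow η (π.weight β h) • (B α β * Uq.k η D h) := by
  have h1 := congr_fun (congr_fun (hB (Uq.k η D h)).eq α) β
  rw [act_comul_k, Matrix.mul_diagonal, Matrix.diagonal_mul, smul_mul_assoc, mul_smul_comm] at h1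
  exact h1.symm

theorem commute_k_quantumStr (hB : ∀ a, Commute B (π.act (Uq.comul η D a))) (h : 𝔥) :
    Commute (Uq.k η D h) (π.quantumStr ρ B) := by
  refine Commute.sum_right _ _ _ fun α _ => Commute.smul_right ?_ _
  have h1 := k_mul_entry hB h α α
  exact smul_right_injective _ (qpow_ne_zero _) h1

/-- `π(u)` preserves the eigenspaces of `q^x`, so a nonzero entry forces equal eigenvalues at its
two indices. -/
theorem mat_mul_qpow {u : Uq η D} {x : 𝔥} (hu : Uq.k η D x * u = u * Uq.k η D x) (α β : Fin n) :
    qpow η (π.weight α x) * π.mat u α β = qpow η (π.weight β x) * π.mat u α β := by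
  have h := congrArg (fun a => π.mat a α β) hu
  simp only [map_mul, π.mat_k] at h
  rw [Matrix.diagonal_mul, Matrix.mul_diagonal] at h
  rw [h, mul_comm]

theorem sgn_mul_mat {u : Uq η D} {s : ZMod 2} (hu : u ∈ Uq.gr η D s) (α β : Fin n) :
    sgn (π.parity α + π.parity β) * π.mat u α β = sgn s * π.mat u α β := by
  have h := π.mat_par u α β
  have h1 : Uq.par η D u = sgn s • u := hu
  rw [h1, map_smul, Matrix.smul_apply, smul_eq_mul] at h
  exact h.symm

/-- If `u` is skew-primitive and commutes with `q^{2 h_ρ - 2 c}`, then it commutes with the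
quantum supertrace of a matrix that commutes with the coproduct. -/
theorem commute_quantumStr {u : Uq η D} {s : ZMod 2} {c : 𝔥} (hu : u ∈ Uq.gr η D s)
    (hΔ : Uq.comul η D u = Uq.k η D c ᵍ⊗ₜ[ℂ] u + u ᵍ⊗ₜ[ℂ] Uq.k η D (-c))
    (hc : Uq.k η D ((2 : ℂ) • D.dualVec ρ - (2 : ℂ) • c) * u =
      u * Uq.k η D ((2 : ℂ) • D.dualVec ρ - (2 : ℂ) • c))
    (hB : ∀ a, Commute B (π.act (Uq.comul η D a))) :
    Commute u (π.quantumStr ρ B) := by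
  set x : 𝔥 := (2 : ℂ) • D.dualVec ρ
  set K : Uq η D := Uq.k η D (-c)
  set d : Fin n → ℂ := fun α => qpow η (π.weight α c) * sgn (π.parity α * s)
  -- `w α` is the supertrace weight divided by the coefficient `d α` of `u` in the diagonal part of
  -- `Δ(u)`, as `hwd` records.
  set w : Fin n → ℂ := fun α =>
    sgn (π.parity α) * qpow η (π.weight α x) * (qpow η (-π.weight α c) * sgn (π.parity α * s))
  have hwd : ∀ α, w α * d α = sgn (π.parity α) * qpow η (π.weight α x) := by
    intro α
    have h1 : qpow η (-π.weight α c) * qpow η (π.weight α c) = 1 := by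
      rw [← qpow_add, neg_add_cancel, qpow_zero]
    have h2 := sgn_mul_self (π.parity α * s)
    simp only [w, d]
    linear_combination (sgn (π.parity α) * qpow η (π.weight α x)) *
      (sgn (π.parity α * s) * sgn (π.parity α * s) * h1 + h2)
  have hact : π.act (Uq.comul η D u) =
      Matrix.diagonal (fun α => d α • u) + Matrix.of fun α β => π.mat u α β • K := by
    ext α β
    rw [hΔ, act_add, Matrix.add_apply, Matrix.add_apply, act_tmul π _ hu,
      act_tmul π _ (Uq.k_mem _), π.mat_k, mul_zero, sgn_zero, mul_one, Matrix.of_apply]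
    congr 1
    by_cases hαβ : α = β
    · subst hαβ
      rw [Matrix.diagonal_apply_eq, Matrix.diagonal_apply_eq]
    · rw [Matrix.diagonal_apply_ne _ hαβ, Matrix.diagonal_apply_ne _ hαβ, zero_mul, zero_smul]
  have hdiag : ∀ α, d α • (B α α * u) + ∑ β, π.mat u β α • (B α β * K) =
      d α • (u * B α α) + ∑ β, π.mat u α β • (K * B β α) := by
    intro α
    have h := congr_fun (congr_fun (hB u).eq α) α
    rw [hact, mul_add, add_mul, Matrix.add_apply, Matrix.add_apply, Matrix.mul_diagonal,
      Matrix.diagonal_mul, Matrix.mul_apply, Matrix.mul_apply] at h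
    simpa only [Matrix.of_apply, mul_smul_comm, smul_mul_assoc] using h
  have hKB : ∀ α β, K * B α β = qpow η (π.weight α c - π.weight β c) • (B α β * K) := by
    intro α β
    have h := k_mul_entry hB (-c) α β
    refine smul_right_injective _ (qpow_ne_zero (η := η) (π.weight α (-c))) ?_
    simp only [smul_smul, ← qpow_add]
    rw [show π.weight α (-c) + (π.weight α c - π.weight β c) = π.weight β (-c) by
      rw [map_neg, map_neg]; ring]
    exact h
  -- Where the entry is nonzero, `hc` equates `q^{λ(2 h_ρ - 2c)}` at the two indices and homogeneity
  -- of `u` gives `[α] + [β] = s`; the powers of `q` and the signs then match separately.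
  have hcoef : ∀ α β, w α * π.mat u β α =
      w β * (π.mat u β α * qpow η (π.weight α c - π.weight β c)) := by
    intro α β
    by_cases h0 : π.mat u β α = 0
    · rw [h0, mul_zero, zero_mul, mul_zero]
    have h1 := mul_right_cancel₀ h0 (mat_mul_qpow (π := π) hc β α)
    have hs : π.parity β + π.parity α = s :=
      BasicLieSuperalgebra.sgn_injective (mul_right_cancel₀ h0 (sgn_mul_mat (π := π) hu β α))
    -- Both sides equal `a * b`.
    have hsign : ∀ a b : ZMod 2, a + a * (b + a) = b + b * (b + a) := by decide
    have h2 := congrArg sgn (hsign (π.parity α) (π.parity β))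
    rw [hs, sgn_add, sgn_add] at h2
    have h3 : qpow η (π.weight α x) * qpow η (-π.weight α c) = qpow η (π.weight β x) *
        qpow η (-π.weight β c) * qpow η (π.weight α c - π.weight β c) := by
      have h4 := congrArg (· * qpow η (π.weight α c)) h1
      simp only [← qpow_add, map_sub, map_smul, smul_eq_mul] at h4 ⊢
      convert h4.symm using 2 <;> ring
    simp only [w]
    linear_combination π.mat u β α * (qpow η (π.weight α x) * qpow η (-π.weight α c) * h2 +
      sgn (π.parity β) * sgn (π.parity β * s) * h3)
  -- Exchanging the indices on one side puts the same entries of `π(u)` and `B` in both sums; moving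
  -- `K` past `B α β` produces the factor absorbed by `hcoef`.
  have hoff : ∑ α, w α • ∑ β, π.mat u β α • (B α β * K) =
      ∑ α, w α • ∑ β, π.mat u α β • (K * B β α) := by
    simp only [Finset.smul_sum, smul_smul]
    rw [Finset.sum_comm]
    refine Finset.sum_congr rfl fun β _ => Finset.sum_congr rfl fun α _ => ?_
    rw [hKB, smul_smul, hcoef, mul_assoc (w β)]
  have hsum : ∑ α, w α • (d α • (B α α * u) + ∑ β, π.mat u β α • (B α β * K)) =
      ∑ α, w α • (d α • (u * B α α) + ∑ β, π.mat u α β • (K * B β α)) :=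
    Finset.sum_congr rfl fun α _ => by rw [hdiag]
  simp only [smul_add, Finset.sum_add_distrib, smul_smul (w _) (d _), hwd] at hsum
  rw [hoff, add_left_inj] at hsum
  change u * _ = _ * u
  simp only [quantumStr, Finset.mul_sum, Finset.sum_mul, mul_smul_comm, smul_mul_assoc]
  exact hsum.symm

end QuantumStr

end Rep

end Quantum

end QSuper

end

/-! ### Centrality of the invariants -/

open QSuper in
theorem mainTheorem9 {ι L : Type*} [AddCommGroup L] [Module ℂ L] [FiniteDimensional ℂ L]
    (S : BasicLieSuperalgebra ι L) (η : ℂ) (hη : qdiff η ≠ 0)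
    (R : UniversalRMatrix η S.datum) (Λ : Module.Dual ℂ S.cartan) (n : ℕ)
    (π : Rep η S.datum n) (hπ : π.IsIrreducible) (hΛ : π.HasHighestWeight Λ)
    (m : ℕ) (a : Uq η S.datum) :
    a * π.invariant R S.rho m = π.invariant R S.rho m * a := by
  have hB : ∀ a, Commute (π.charMatrix R ^ m) (π.act (Uq.comul η S.datum a)) := fun a =>
    (π.commute_charMatrix R a).pow_left m
  -- With `c = h_i / 2` from the coproduct, this is `α_i(2 h_ρ - h_i) = 0`, which makes `q^{2 h_ρ -
  -- 2c}` commute with both `e_i` and `f_i`.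
  have hroot : ∀ i, S.datum.root i ((2 : ℂ) • S.datum.dualVec S.rho -
      (2 : ℂ) • ((1 / 2 : ℂ) • S.datum.simpleH i)) = 0 := by
    intro i
    rw [smul_smul, mul_one_div_cancel two_ne_zero, one_smul, map_sub, sub_eq_zero]
    exact S.root_two_rho i
  rw [Rep.invariant_eq_quantumStr]
  refine Uq.commute_of_generators (fun i => ?_) (fun i => ?_) (fun h => ?_) a
  · refine Rep.commute_quantumStr (Uq.e_mem i) (Uq.comul_e i) ?_ hB
    rw [Uq.k_e, hroot, qpow_zero, one_smul]
  · refine Rep.commute_quantumStr (Uq.f_mem i) (Uq.comul_f i) ?_ hB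
    rw [Uq.k_f, hroot, neg_zero, qpow_zero, one_smul]
  · exact Rep.commute_k_quantumStr hB h
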